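/- Let $\mathbb{X}$ and $\mathbb{Y}$ be locally compact Polish spaces equipped with locally finite positive Borel measures $\lambda$ and $\nu$. Let $U:\mathbb{X}\to\mathbb{R}$ and $V:\mathbb{Y}\to\mathbb{R}$ be locally bounded functions with compact sub-level sets, and let $W:\mathbb{X}\times\mathbb{Y}\to\mathbb{R}$ be a measurable, locally bounded function with $\sup e^{-W}<\infty$. For a function $F$ write $\lambda_F(dx)=e^{-F(x)}\lambda(dx)$ and $\nu_F(dy)=e^{-F(y)}\nu(dy)$. Assume that $\mu:=\lambda_U$ and $\eta:=\nu_V$ are probability measures and that $K(x,dy)=e^{-W(x,y)}\nu(dy)$ is a Markov transition from $\mathbb{X}$ to $\mathbb{Y}$. **Sinkhorn transitions.** Set $\mathcal{K}_0=K$. For $n\ge 0$, define the densities $k_{2n}(x,\cdot)=d\mathcal{K}_{2n}(x,\cdot)/d\nu$ and $k_{2n+1}(y,\cdot)=d\mathcal{K}_{2n+1}(y,\cdot)/d\lambda$ successively, at every point, from $k_0(x,y)=e^{-W(x,y)}$ by Bayes' rule $$k_{2n+1}(y,x)=\frac{e^{-U(x)}k_{2n}(x,y)}{\int e^{-U(x')}k_{2n}(x',y)\,\lambda(dx')},\qquad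 k_{2n+2}(x,y)=\frac{e^{-V(y)}k_{2n+1}(y,x)}{\int e^{-V(y')}k_{2n+1}(y',x)\,\nu(dy')}.$$ Put $\pi_{2n}=\mu\mathcal{K}_{2n}$, $\pi_{2n+1}=\eta\mathcal{K}_{2n+1}$, $\mathcal{S}_{2n+1}=\mathcal{K}_{2n}\mathcal{K}_{2n+1}$ (first $\mathcal{K}_{2n}$, then $\mathcal{K}_{2n+1}$) and $\mathcal{S}_{2(n+1)}=\mathcal{K}_{2n+1}\mathcal{K}_{2(n+1)}$. **Condition $(\mathtt{A})$.** Let $\mathcal{B}_0$ be the set of functions $\theta>0$ such that $1/\theta$ is locally bounded above, bounded below by a positive constant, and has compact sub-level sets. Assume that $\delta\in\,]0,1/2[$ is such that $\lambda_{(1-2\delta)U}$ and $\nu_{(1-2\delta)V}$ have finite total mass, that the integrals $W^V(x)=\int W(x,y)\,\nu_V(dy)$ and $W_U(y)=\int W(x,y)\,\lambda_U(dx)$ are finite for all $x$ and $y$, and that there are $\theta_u\in\mathcal{B}_0(\mathbb{X})$ and $\theta_v\in\mathcal{B}_0(\mathbb{Y})$ with $$e^{-(\delta U-W^V)}\le\theta_u\qquad\text{and}\qquad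 e^{-(\delta V-W_U)}\le\theta_v .$$ **Weighted norms.** For a positive function $g$ let $|\!|\!|\mu_1-\mu_2|\!|\!|_g=|\mu_1-\mu_2|(g)$, where $|\mu_1-\mu_2|$ is the total variation measure, and let $$\mathsf{lip}_{g,h}(L)=\sup\frac{|\!|\!|\mu_1L-\mu_2L|\!|\!|_h}{|\!|\!|\mu_1-\mu_2|\!|\!|_g}$$ over all probability measures $\mu_1,\mu_2$ with $\mu_1(g),\mu_2(g)<\infty$ and $|\!|\!|\mu_1-\mu_2|\!|\!|_g>0$. For $a>0$ put $g_a=\tfrac12+a\,e^{\delta U}$ and $h_a=\tfrac12+a\,e^{\delta V}$. **Claim.** All $\mathcal{K}_n$, $n\ge 0$, are Markov transitions, and there exist $a>0$ and $\varrho\in\,]0,1[$ such that $$\mathsf{lip}_{g_a,h_a}(\mathcal{K}_{2n})\vee\mathsf{lip}_{h_a,g_a}(\mathcal{K}_{2n+1})\le\varrho\qquad\text{for all }n\ge 1.\tag{1}$$ Moreover, for all $a>0$ and $\varrho\in\,]0,1[$ satisfying (1) we have $$\sup_{n\ge 1}\Big(\mathsf{lip}_{g_a,g_a}(\mathcal{S}_{2n+1})\vee\mathsf{lip}_{h_a,h_a}(\mathcal{S}_{2(n+1)})\Big)\le\varrho^2,$$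 and, for every $n\ge 1$, $$|\!|\!|\pi_{2(n+1)}-\eta|\!|\!|_{h_a}\le\varrho^2\,|\!|\!|\pi_{2n}-\eta|\!|\!|_{h_a}\qquad\text{and}\qquad|\!|\!|\pi_{2n+1}-\mu|\!|\!|_{g_a}\le\varrho^2\,|\!|\!|\pi_{2n-1}-\mu|\!|\!|_{g_a}.$$ -/

import Mathlib

open MeasureTheory ProbabilityTheory Filter Topology
open scoped ENNReal

noncomputable section

namespace Sinkhorn

/-- The function `f` is bounded on a neighbourhood of every point. -/
def LocallyBounded {Z : Type*} [TopologicalSpace Z] (f : Z → ℝ) : Prop :=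
  ∀ z, ∃ C : ℝ, ∀ᶠ w in 𝓝 z, |f w| ≤ C

/-- All sub-level sets `{f ≤ l}`, `l` real, are compact. -/
def CompactSublevels {Z : Type*} [TopologicalSpace Z] (f : Z → ℝ) : Prop :=
  ∀ l : ℝ, IsCompact {z | f z ≤ l}

/-- The class `B_∞` of locally upper bounded, uniformly positive functions with compact
sub-level sets. -/
structure IsBInfty {Z : Type*} [TopologicalSpace Z] (f : Z → ℝ) : Prop where
  locally_upper_bounded : ∀ z, ∃ C : ℝ, ∀ᶠ w in 𝓝 z, f w ≤ C
  uniformly_positive : ∃ c : ℝ, 0 < c ∧ ∀ z, c ≤ f z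
  compact_sublevels : CompactSublevels f

/-- The class `B_0` of the functions `θ` such that `1 / θ` belongs to `B_∞`
(such a `θ` is automatically positive). -/
def IsBZero {Z : Type*} [TopologicalSpace Z] (θ : Z → ℝ) : Prop :=
  IsBInfty fun z => 1 / θ z

/-- The Gibbs measure `ρ_F(dz) = e^{-F(z)} ρ(dz)`. -/
def gibbs {Z : Type*} [MeasurableSpace Z] (ρ : Measure Z) (F : Z → ℝ) : Measure Z :=
  ρ.withDensity fun z => ENNReal.ofReal (Real.exp (-F z))

/-- Condition (A) for the parameter `δ`. The integrals `W^V(x) = ∫ W(x,y) ν_V(dy)` and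
`W_U(y) = ∫ W(x,y) λ_U(dx)` are required to be finite, since `e^{-(δU - W^V)} ≤ θ_u < ∞` and
`e^{-(δV - W_U)} ≤ θ_v < ∞` only make sense or hold in this case. -/
structure ConditionA {X Y : Type*} [TopologicalSpace X] [TopologicalSpace Y]
    [MeasurableSpace X] [MeasurableSpace Y] (lam : Measure X) (nu : Measure Y)
    (U : X → ℝ) (V : Y → ℝ) (W : X → Y → ℝ) (δ : ℝ) : Prop where
  delta_pos : 0 < δ
  delta_lt : δ < 1 / 2
  finite_left : gibbs lam (fun x => (1 - 2 * δ) * U x) Set.univ < ∞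
  finite_right : gibbs nu (fun y => (1 - 2 * δ) * V y) Set.univ < ∞
  integrable_left : ∀ x, Integrable (fun y => W x y) (gibbs nu V)
  integrable_right : ∀ y, Integrable (fun x => W x y) (gibbs lam U)
  exists_theta_left : ∃ θ : X → ℝ, IsBZero θ ∧
    ∀ x, Real.exp (-(δ * U x - ∫ y, W x y ∂(gibbs nu V))) ≤ θ x
  exists_theta_right : ∃ θ : Y → ℝ, IsBZero θ ∧
    ∀ y, Real.exp (-(δ * V y - ∫ x, W x y ∂(gibbs lam U))) ≤ θ y

/-- Bayes' rule for densities. If `p` is the density with respect to `ρ` of a random variable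
`A`, and `q a` is the conditional density of `B` given `A = a`, then `bayes ρ p q b` is the
conditional density with respect to `ρ` of `A` given `B = b`. -/
def bayes {A B : Type*} [MeasurableSpace A] (ρ : Measure A) (p : A → ℝ≥0∞)
    (q : A → B → ℝ≥0∞) : B → A → ℝ≥0∞ :=
  fun b a => p a * q a b / ∫⁻ a', p a' * q a' b ∂ρ

section Transitions

variable {X Y : Type*} [MeasurableSpace X] [MeasurableSpace Y]
  (lam : Measure X) (nu : Measure Y) (U : X → ℝ) (V : Y → ℝ) (W : X → Y → ℝ)

/-- The density `y ↦ k_{2n}(x,y)` of the Sinkhorn transition `K_{2n}(x,dy)` with respect to `ν`.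
It starts from `e^{-W(x,y)}`. Then `K_{2n+1}` is the conditional law of the first coordinate given
the second one under `λ_U × K_{2n}`, and `K_{2n+2}` is the conditional law of the second
coordinate given the first one under `ν_V(dy) K_{2n+1}(y,dx)`. -/
def evenDensity : ℕ → X → Y → ℝ≥0∞
  | 0 => fun x y => ENNReal.ofReal (Real.exp (-W x y))
  | n + 1 => bayes nu (fun y => ENNReal.ofReal (Real.exp (-V y)))
      (bayes lam (fun x => ENNReal.ofReal (Real.exp (-U x))) (evenDensity n))

/-- The density `x ↦ k_{2n+1}(y,x)` of `K_{2n+1}(y,dx)` with respect to `λ`. -/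
def oddDensity (n : ℕ) : Y → X → ℝ≥0∞ :=
  bayes lam (fun x => ENNReal.ofReal (Real.exp (-U x))) (evenDensity lam nu U V W n)

/-- The Sinkhorn transition `K_{2n}` from `X` into `Y`. -/
def evenK [SFinite nu] (n : ℕ) : Kernel X Y :=
  Kernel.withDensity (Kernel.const X nu) (evenDensity lam nu U V W n)

/-- The Sinkhorn transition `K_{2n+1}` from `Y` into `X`. -/
def oddK [SFinite lam] (n : ℕ) : Kernel Y X :=
  Kernel.withDensity (Kernel.const Y lam) (oddDensity lam nu U V W n)

/-- The Sinkhorn marginal `π_{2n} = μ K_{2n}` with `μ = λ_U`. -/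
def evenMarginal [SFinite nu] (n : ℕ) : Measure Y :=
  (gibbs lam U).bind (evenK lam nu U V W n)

/-- The Sinkhorn marginal `π_{2n+1} = η K_{2n+1}` with `η = ν_V`. -/
def oddMarginal [SFinite lam] (n : ℕ) : Measure X :=
  (gibbs nu V).bind (oddK lam nu U V W n)

/-- The Gibbs-type transition `S_{2n+1} = K_{2n} K_{2n+1}` from `X` into itself
(first `K_{2n}`, then `K_{2n+1}`). -/
def oddS [SFinite lam] [SFinite nu] (n : ℕ) : Kernel X X :=
  Kernel.comp (oddK lam nu U V W n) (evenK lam nu U V W n)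

/-- The Gibbs-type transition `S_{2(n+1)} = K_{2n+1} K_{2(n+1)}` from `Y` into itself
(first `K_{2n+1}`, then `K_{2(n+1)}`). -/
def evenS [SFinite lam] [SFinite nu] (n : ℕ) : Kernel Y Y :=
  Kernel.comp (evenK lam nu U V W (n + 1)) (oddK lam nu U V W n)

end Transitions

/-- The `g`-weighted total variation norm `|m₁ - m₂|(g)`. For finite measures the truncated
differences `m₁ - m₂` and `m₂ - m₁` of measures are the positive and negative parts of the
Hahn-Jordan decomposition, see `weightedTV_eq_totalVariation`. -/
def weightedTV {Z : Type*} [MeasurableSpace Z] (g : Z → ℝ) (m₁ m₂ : Measure Z) : ℝ≥0∞ :=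
  ∫⁻ z, ENNReal.ofReal (g z) ∂((m₁ - m₂) + (m₂ - m₁))

theorem weightedTV_eq_totalVariation {Z : Type*} [MeasurableSpace Z] (g : Z → ℝ)
    (m₁ m₂ : Measure Z) [IsFiniteMeasure m₁] [IsFiniteMeasure m₂] :
    weightedTV g m₁ m₂ = ∫⁻ z, ENNReal.ofReal (g z)
      ∂(m₁.toSignedMeasure - m₂.toSignedMeasure).totalVariation := by
  rw [SignedMeasure.totalVariation, Measure.toJordanDecomposition_toSignedMeasure_sub]
  rfl

/-- The set `Prob_g(Z)` of the probability measures `m` with `m(g) < ∞`. -/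
def probG {Z : Type*} [MeasurableSpace Z] (g : Z → ℝ) : Set (Measure Z) :=
  {m | IsProbabilityMeasure m ∧ ∫⁻ z, ENNReal.ofReal (g z) ∂m < ∞}

/-- The weighted Lipschitz constant `lip_{g,h}(K)`: the supremum of
`|m₁K - m₂K|(h) / |m₁ - m₂|(g)` over all `m₁, m₂` in `Prob_g` with `|m₁ - m₂|(g) > 0`. -/
def lip {Z Z' : Type*} [MeasurableSpace Z] [MeasurableSpace Z'] (g : Z → ℝ) (h : Z' → ℝ)
    (K : Kernel Z Z') : ℝ≥0∞ :=
  ⨆ (m₁ : Measure Z) (m₂ : Measure Z) (_ : m₁ ∈ probG g) (_ : m₂ ∈ probG g)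
    (_ : 0 < weightedTV g m₁ m₂),
    weightedTV h (m₁.bind K) (m₂.bind K) / weightedTV g m₁ m₂

/-- The weight `1/2 + a e^{δF}`. -/
def weight {Z : Type*} (a δ : ℝ) (F : Z → ℝ) : Z → ℝ :=
  fun z => 1 / 2 + a * Real.exp (δ * F z)

/-- The contraction estimates
`lip_{g_a,h_a}(K_{2n}) ∨ lip_{h_a,g_a}(K_{2n+1}) ≤ r` for all `n ≥ 1`,
with the weights `g_a = 1/2 + a e^{δU}` and `h_a = 1/2 + a e^{δV}`. -/
def LipSinkhorn {X Y : Type*} [MeasurableSpace X] [MeasurableSpace Y]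
    (lam : Measure X) (nu : Measure Y) [SFinite lam] [SFinite nu]
    (U : X → ℝ) (V : Y → ℝ) (W : X → Y → ℝ) (δ a r : ℝ) : Prop :=
  ∀ n : ℕ, 1 ≤ n →
    lip (weight a δ U) (weight a δ V) (evenK lam nu U V W n) ⊔
      lip (weight a δ V) (weight a δ U) (oddK lam nu U V W n) ≤ ENNReal.ofReal r

end Sinkhorn

end

/-! Every Sinkhorn transition is a rescaling of the one kernel `e^{-W}`. With `μ = λ_U`, `η = ν_V`,
put `u_0 = 1`, `v_n(y) = 1 / ∫ e^{-W} u_n dμ` and `u_{n+1}(x) = 1 / ∫ e^{-W} v_n dη`. A factor that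
depends only on the conditioning variable cancels in Bayes' rule, so `k_{2n+1} = e^{-U} e^{-W} u_n
v_n` and `k_{2n+2} = e^{-V} e^{-W} v_n u_{n+1}` (`oddDensity_eq`, `evenDensity_succ_eq`).

The potentials are controlled uniformly in `n`. Jensen's inequality gives `u_{n+1} ≤ exp(W^V - ∫ log
v_n dη)`, and symmetrically for `v_n`. The integrals of `log u_n` and `log v_n` do not decrease in
`n` (`integral_log_le_integral_log_schrodinger`), hence `u_n ≤ M e^{W^V}` and `v_n ≤ e^{W_U}`, where
`M` bounds `e^{-W}`. Inserting these upper bounds in the recursion yields uniform positive lower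
bounds.

Condition (A) makes `e^{W^V}` negligible against `e^{δU}` outside compact sets. The upper bounds
therefore give a drift inequality between `e^{δU}` and `e^{δV}` with factor `1/4`
(`exists_drift_potential`), and the lower bounds with local boundedness of `W` give a minorization
on sub-level sets (`minorized_potential`), with constants independent of `n`. A Hairer–Mattingly
argument turns drift and minorization into a contraction in the weighted norm
(`lip_le_of_drift_of_minorized`).

The remaining claims follow from submultiplicativity of `lip` and from the invariance of `μ` and `η`
under the Gibbs-type transitions, through `π_{2n} K_{2n+1} = μ` and `π_{2n+1} K_{2n+2} = η`. -/

namespace Sinkhorn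

/-! ### Weighted total variation and its dual description. -/

section WeightedTV

variable {Z : Type*} [MeasurableSpace Z]

/-- This is the Jordan decomposition of the signed measure `m₁ - m₂`, with negative terms moved
across so that only positive measures occur. -/
theorem add_sub_eq_add_sub (m₁ m₂ : Measure Z) [IsFiniteMeasure m₁] [IsFiniteMeasure m₂] :
    m₁ + (m₂ - m₁) = m₂ + (m₁ - m₂) := by
  have h := Measure.sub_toSignedMeasure_eq_toSignedMeasure_sub (μ := m₁) (ν := m₂)
  rw [sub_eq_sub_iff_add_eq_add, ← Measure.toSignedMeasure_add, ← Measure.toSignedMeasure_add,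
    Measure.toSignedMeasure_eq_toSignedMeasure_iff] at h
  rw [h, add_comm]

theorem integrable_iff_lintegral_lt_top {g : Z → ℝ} (hg : Measurable g) (h0 : ∀ z, 0 ≤ g z)
    (m : Measure Z) : Integrable g m ↔ ∫⁻ z, ENNReal.ofReal (g z) ∂m < ∞ := by
  rw [← hasFiniteIntegral_iff_ofReal (Eventually.of_forall h0)]
  exact ⟨fun h => h.2, fun h => ⟨hg.aestronglyMeasurable, h⟩⟩

theorem weightedTV_le (g : Z → ℝ) (m₁ m₂ : Measure Z) :
    weightedTV g m₁ m₂ ≤ ∫⁻ z, ENNReal.ofReal (g z) ∂m₁ + ∫⁻ z, ENNReal.ofReal (g z) ∂m₂ := by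
  rw [weightedTV, lintegral_add_measure]
  exact add_le_add (lintegral_mono' Measure.sub_le le_rfl) (lintegral_mono' Measure.sub_le le_rfl)

theorem weightedTV_eq_ofReal {g : Z → ℝ} (h0 : ∀ z, 0 ≤ g z) {m₁ m₂ : Measure Z}
    (h₁ : Integrable g m₁) (h₂ : Integrable g m₂) :
    weightedTV g m₁ m₂ = ENNReal.ofReal (∫ z, g z ∂(m₁ - m₂) + ∫ z, g z ∂(m₂ - m₁)) := by
  have i₁ : Integrable g (m₁ - m₂) := h₁.mono_measure Measure.sub_le
  have i₂ : Integrable g (m₂ - m₁) := h₂.mono_measure Measure.sub_le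
  rw [weightedTV, ← integral_add_measure i₁ i₂,
    ofReal_integral_eq_lintegral_ofReal (i₁.add_measure i₂) (Eventually.of_forall h0)]

theorem integral_sub_integral_le_weightedTV {g ψ : Z → ℝ} (hψ : Measurable ψ)
    (h : ∀ z, |ψ z| ≤ g z) {m₁ m₂ : Measure Z} [IsFiniteMeasure m₁] [IsFiniteMeasure m₂]
    (h₁ : Integrable g m₁) (h₂ : Integrable g m₂) :
    ∫ z, ψ z ∂m₁ - ∫ z, ψ z ∂m₂ ≤ ∫ z, g z ∂(m₁ - m₂) + ∫ z, g z ∂(m₂ - m₁) := by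
  have i₁ : Integrable g (m₁ - m₂) := h₁.mono_measure Measure.sub_le
  have i₂ : Integrable g (m₂ - m₁) := h₂.mono_measure Measure.sub_le
  have hi : ∀ {m : Measure Z}, Integrable g m → Integrable ψ m := fun hm =>
    hm.mono' hψ.aestronglyMeasurable (Eventually.of_forall h)
  have key : ∫ z, ψ z ∂m₁ + ∫ z, ψ z ∂(m₂ - m₁) = ∫ z, ψ z ∂m₂ + ∫ z, ψ z ∂(m₁ - m₂) := by
    rw [← integral_add_measure (hi h₁) (hi i₂), ← integral_add_measure (hi h₂) (hi i₁),
      add_sub_eq_add_sub]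
  have e₁ : ∫ z, ψ z ∂(m₁ - m₂) ≤ ∫ z, g z ∂(m₁ - m₂) :=
    integral_mono (hi i₁) i₁ fun z => (abs_le.1 (h z)).2
  have e₂ : ∫ z, -g z ∂(m₂ - m₁) ≤ ∫ z, ψ z ∂(m₂ - m₁) :=
    integral_mono i₂.neg (hi i₂) fun z => (abs_le.1 (h z)).1
  rw [integral_neg] at e₂
  linarith

/-- The extremal test function is `g` times the sign given by a Hahn decomposition; the dual
supremum is attained. -/
theorem exists_integral_sub_integral_eq_weightedTV {g : Z → ℝ} (hg : Measurable g)
    (h0 : ∀ z, 0 ≤ g z) {m₁ m₂ : Measure Z} [IsFiniteMeasure m₁] [IsFiniteMeasure m₂]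
    (h₁ : Integrable g m₁) (h₂ : Integrable g m₂) :
    ∃ f : Z → ℝ, Measurable f ∧ (∀ z, |f z| ≤ g z) ∧
      ∫ z, f z ∂m₁ - ∫ z, f z ∂m₂ = ∫ z, g z ∂(m₁ - m₂) + ∫ z, g z ∂(m₂ - m₁) := by
  classical
  obtain ⟨s, hs, hs₁, hs₂⟩ := Measure.mutually_singular_measure_sub (μ := m₁) (ν := m₂)
  have i₁ : Integrable g (m₁ - m₂) := h₁.mono_measure Measure.sub_le
  have i₂ : Integrable g (m₂ - m₁) := h₂.mono_measure Measure.sub_le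
  -- `m₁ - m₂` vanishes on `s` and `m₂ - m₁` off `s`, hence the minus sign on `s`.
  set f : Z → ℝ := s.piecewise (fun z => -g z) g with hf
  have hfm : Measurable f := Measurable.piecewise hs hg.neg hg
  have hfg : ∀ z, |f z| ≤ g z := by
    intro z
    by_cases hz : z ∈ s
    · simp [hf, hz, abs_of_nonneg (h0 z)]
    · simp [hf, hz, abs_of_nonneg (h0 z)]
  have hi : ∀ {m : Measure Z}, Integrable g m → Integrable f m := fun hm =>
    hm.mono' hfm.aestronglyMeasurable (Eventually.of_forall hfg)
  refine ⟨f, hfm, hfg, ?_⟩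
  have key : ∫ z, f z ∂m₁ + ∫ z, f z ∂(m₂ - m₁) = ∫ z, f z ∂m₂ + ∫ z, f z ∂(m₁ - m₂) := by
    rw [← integral_add_measure (hi h₁) (hi i₂), ← integral_add_measure (hi h₂) (hi i₁),
      add_sub_eq_add_sub]
  have e₁ : ∫ z, f z ∂(m₁ - m₂) = ∫ z, g z ∂(m₁ - m₂) := by
    refine integral_congr_ae ?_
    filter_upwards [measure_eq_zero_iff_ae_notMem.1 hs₁] with z hz
    simp [hf, hz]
  have e₂ : ∫ z, f z ∂(m₂ - m₁) = ∫ z, -g z ∂(m₂ - m₁) := by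
    refine integral_congr_ae ?_
    filter_upwards [measure_eq_zero_iff_ae_notMem.1 hs₂] with z hz
    have hz' : z ∈ s := by simpa using hz
    simp [hf, hz']
  rw [integral_neg] at e₂
  linarith

theorem eq_of_weightedTV_eq_zero {g : Z → ℝ} (hg : Measurable g) (h0 : ∀ z, 0 < g z)
    {m₁ m₂ : Measure Z} [IsFiniteMeasure m₁] [IsFiniteMeasure m₂]
    (h : weightedTV g m₁ m₂ = 0) : m₁ = m₂ := by
  rw [weightedTV, lintegral_eq_zero_iff hg.ennreal_ofReal] at h
  have h' : (m₁ - m₂) + (m₂ - m₁) = 0 := by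
    rw [← ae_eq_bot, ← Filter.eventually_false_iff_eq_bot]
    filter_upwards [h] with z hz
    have := h0 z
    simp at hz
    linarith
  have h₁ : m₁ - m₂ = 0 := le_antisymm (h' ▸ Measure.le_add_right le_rfl) (Measure.zero_le _)
  have h₂ : m₂ - m₁ = 0 := le_antisymm (h' ▸ Measure.le_add_left le_rfl) (Measure.zero_le _)
  simpa [h₁, h₂] using add_sub_eq_add_sub m₁ m₂

theorem weightedTV_self (g : Z → ℝ) (m : Measure Z) [IsFiniteMeasure m] :
    weightedTV g m m = 0 := by
  simp [weightedTV]

end WeightedTV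

/-! ### Weighted Lipschitz constants of kernels. -/

section Lip

variable {Z Z' Z'' : Type*} [MeasurableSpace Z] [MeasurableSpace Z'] [MeasurableSpace Z'']

/-- The supremum in `lip` skips pairs at distance zero; there positivity of `g` forces `m₁ = m₂`.
Division is legitimate since the distance is finite on `probG g`. -/
theorem weightedTV_bind_le_lip_mul {g : Z → ℝ} (h : Z' → ℝ) (hg : Measurable g)
    (h0 : ∀ z, 0 < g z) (K : Kernel Z Z') [IsMarkovKernel K] {m₁ m₂ : Measure Z}
    (h₁ : m₁ ∈ probG g) (h₂ : m₂ ∈ probG g) :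
    weightedTV h (m₁.bind K) (m₂.bind K) ≤ lip g h K * weightedTV g m₁ m₂ := by
  have := h₁.1
  have := h₂.1
  rcases eq_or_ne (weightedTV g m₁ m₂) 0 with h' | h'
  · rw [eq_of_weightedTV_eq_zero hg h0 h', weightedTV_self]
    exact zero_le
  · have ht : weightedTV g m₁ m₂ ≠ ∞ :=
      ((weightedTV_le g m₁ m₂).trans_lt (ENNReal.add_lt_top.2 ⟨h₁.2, h₂.2⟩)).ne
    rw [← ENNReal.div_le_iff h' ht]
    exact le_iSup_of_le m₁ (le_iSup_of_le m₂ (le_iSup_of_le h₁ (le_iSup_of_le h₂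
      (le_iSup_of_le (pos_iff_ne_zero.2 h') le_rfl))))

theorem lip_le {g : Z → ℝ} {h : Z' → ℝ} {K : Kernel Z Z'} {r : ℝ≥0∞}
    (H : ∀ m₁ ∈ probG g, ∀ m₂ ∈ probG g,
      weightedTV h (m₁.bind K) (m₂.bind K) ≤ r * weightedTV g m₁ m₂) : lip g h K ≤ r := by
  refine iSup_le fun m₁ => iSup_le fun m₂ => iSup_le fun h₁ => iSup_le fun h₂ => iSup_le fun _ => ?_
  exact ENNReal.div_le_of_le_mul (H m₁ h₁ m₂ h₂)

theorem lip_comp_le {g : Z → ℝ} {h : Z' → ℝ} {k : Z'' → ℝ} (hg : Measurable g)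
    (g0 : ∀ z, 0 < g z) (hh : Measurable h) (h0 : ∀ z, 0 < h z) (K : Kernel Z Z')
    [IsMarkovKernel K] (L : Kernel Z' Z'') [IsMarkovKernel L]
    (H : ∀ m ∈ probG g, m.bind K ∈ probG h) :
    lip g k (Kernel.comp L K) ≤ lip h k L * lip g h K := by
  refine lip_le fun m₁ h₁ m₂ h₂ => ?_
  rw [← Measure.comp_assoc, ← Measure.comp_assoc, mul_assoc]
  exact (weightedTV_bind_le_lip_mul k hh h0 L (H m₁ h₁) (H m₂ h₂)).trans
    (mul_le_mul_right (weightedTV_bind_le_lip_mul h hg g0 K h₁ h₂) _)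

/-- A Markov kernel whose action on functions bounded by `h` is controlled by `r` at pairs of
points is `r`-Lipschitz on weighted probability measures. -/
theorem lip_le_of_pointwise {g : Z → ℝ} {h : Z' → ℝ} (hg : Measurable g) (g0 : ∀ z, 0 ≤ g z)
    (hh : Measurable h) (h0 : ∀ z, 0 ≤ h z) (K : Kernel Z Z') [IsMarkovKernel K]
    (H : ∀ m ∈ probG g, m.bind K ∈ probG h) {r : ℝ} (hr : 0 ≤ r)
    (hK : ∀ f : Z' → ℝ, Measurable f → (∀ z, |f z| ≤ h z) → ∀ x x',
      ∫ y, f y ∂(K x) - ∫ y, f y ∂(K x') ≤ r * (g x + g x')) :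
    lip g h K ≤ ENNReal.ofReal r := by
  refine lip_le fun m₁ h₁ m₂ h₂ => ?_
  have := h₁.1
  have := h₂.1
  have := (H m₁ h₁).1
  have := (H m₂ h₂).1
  have i₁ := (integrable_iff_lintegral_lt_top hg g0 _).2 h₁.2
  have i₂ := (integrable_iff_lintegral_lt_top hg g0 _).2 h₂.2
  have j₁ := (integrable_iff_lintegral_lt_top hh h0 _).2 (H m₁ h₁).2
  have j₂ := (integrable_iff_lintegral_lt_top hh h0 _).2 (H m₂ h₂).2
  rw [weightedTV_eq_ofReal h0 j₁ j₂, weightedTV_eq_ofReal g0 i₁ i₂, ← ENNReal.ofReal_mul hr]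
  refine ENNReal.ofReal_le_ofReal ?_
  obtain ⟨f, hf, hfh, hfe⟩ := exists_integral_sub_integral_eq_weightedTV hh h0 j₁ j₂
  rw [← hfe]
  have hfi : ∀ {m : Measure Z'}, Integrable h m → Integrable f m := fun hm =>
    hm.mono' hf.aestronglyMeasurable (Eventually.of_forall hfh)
  set φ : Z → ℝ := fun x => ∫ y, f y ∂(K x) with hφ
  have hφm : Measurable φ := (hf.stronglyMeasurable.integral_kernel (κ := K)).measurable
  have hne : Nonempty Z := by
    by_contra hne
    rw [not_nonempty_iff] at hne
    exact (IsProbabilityMeasure.ne_zero m₁) (Measure.eq_zero_of_isEmpty m₁)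
  -- The two-point bound says that every `φ - r g` lies below every `φ + r g`, so a constant
  -- separates them and `|φ - c| ≤ r g`. The shift by `c` is invisible to a difference of
  -- probability measures.
  obtain ⟨c, hc₁, hc₂⟩ : ∃ c, (∀ x, φ x - r * g x ≤ c) ∧ ∀ x, c ≤ φ x + r * g x := by
    have hle : ∀ x x', φ x - r * g x ≤ φ x' + r * g x' := fun x x' => by
      have := hK f hf hfh x x'
      simp only [hφ]
      linarith
    refine ⟨⨆ x, (φ x - r * g x), fun x => ?_, fun x => ciSup_le fun x' => hle x' x⟩
    exact le_ciSup (f := fun x => φ x - r * g x)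
      ⟨φ x + r * g x, by rintro _ ⟨x', rfl⟩; exact hle x' x⟩ x
  have key := integral_sub_integral_le_weightedTV (g := fun x => r * g x) (ψ := fun x => φ x - c)
    (hφm.sub_const c) (fun x => abs_le.2 ⟨by linarith [hc₂ x], by linarith [hc₁ x]⟩)
    (i₁.const_mul r) (i₂.const_mul r)
  have e : ∀ {m : Measure Z} [IsProbabilityMeasure m], Integrable h (m.bind K) →
      ∫ y, f y ∂(m.bind K) = ∫ x, (φ x - c) ∂m + c := by
    intro m _ hm
    have hb : Integrable φ m := by
      refine (Measure.integrable_integral_norm_of_integrable_comp (hfi hm)).mono'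
        hφm.aestronglyMeasurable (Eventually.of_forall fun x => ?_)
      exact norm_integral_le_integral_norm _
    have hmi : Integrable f ((K ∘ₖ Kernel.const Unit m) ()) := by
      rw [← Measure.comp_eq_comp_const_apply]
      exact hfi hm
    rw [integral_sub hb (integrable_const c), Measure.comp_eq_comp_const_apply,
      Kernel.integral_comp hmi]
    simp [hφ]
  rw [e j₁, e j₂]
  simp only [integral_const_mul] at key
  linarith

end Lip

/-! ### From drift and minorization to contraction. -/

section Contraction

variable {Z Z' : Type*} [MeasurableSpace Z] [MeasurableSpace Z']

theorem bind_mem_probG {g : Z → ℝ} {h : Z' → ℝ} (hh : Measurable h)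
    (K : Kernel Z Z') [IsMarkovKernel K] {C : ℝ} (hC : 0 ≤ C)
    (hK : ∀ x, ∫⁻ y, ENNReal.ofReal (h y) ∂(K x) ≤ ENNReal.ofReal (C * g x))
    {m : Measure Z} (hm : m ∈ probG g) : m.bind K ∈ probG h := by
  have := hm.1
  refine ⟨inferInstance, ?_⟩
  rw [Measure.lintegral_bind K.aemeasurable hh.ennreal_ofReal.aemeasurable]
  refine (lintegral_mono hK).trans_lt ?_
  simp_rw [ENNReal.ofReal_mul hC]
  rw [lintegral_const_mul' _ _ ENNReal.ofReal_ne_top]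
  exact ENNReal.mul_lt_top ENNReal.ofReal_lt_top hm.2

/-- Drift of `K` from `f` to `k`. -/
def Drift (K : Kernel Z Z') (f : Z → ℝ) (k : Z' → ℝ) (c : ℝ) : Prop :=
  ∀ x, ∫⁻ y, ENNReal.ofReal (k y) ∂(K x) ≤ ENNReal.ofReal (c + f x / 4)

/-- Minorization of `K` on the sub-level set `{f ≤ R}` by a measure of mass at least `κ`. -/
def Minorized (K : Kernel Z Z') (f : Z → ℝ) (R κ : ℝ) : Prop :=
  ∃ m : Measure Z', ENNReal.ofReal κ ≤ m Set.univ ∧ ∀ x, f x ≤ R → m ≤ K x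

theorem Minorized.mono {K : Kernel Z Z'} {f : Z → ℝ} {R κ κ' : ℝ} (h : Minorized K f R κ)
    (hκ : κ' ≤ κ) : Minorized K f R κ' := by
  obtain ⟨m, h₁, h₂⟩ := h
  exact ⟨m, (ENNReal.ofReal_le_ofReal hκ).trans h₁, h₂⟩

theorem Drift.mono {K : Kernel Z Z'} {f : Z → ℝ} {k : Z' → ℝ} {c c' : ℝ} (h : Drift K f k c)
    (hc : c ≤ c') : Drift K f k c' :=
  fun x => (h x).trans (ENNReal.ofReal_le_ofReal (by linarith))

variable {K : Kernel Z Z'} {f : Z → ℝ} {k : Z' → ℝ} {c : ℝ}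

theorem Drift.bind_mem_probG [IsMarkovKernel K] (hd : Drift K f k c) (hk : Measurable k)
    (k0 : ∀ y, 0 ≤ k y) (f0 : ∀ x, 0 ≤ f x) (hc : 0 ≤ c) {a : ℝ} (ha : 0 ≤ a) {m : Measure Z}
    (hm : m ∈ probG fun z => 1 / 2 + a * f z) : m.bind K ∈ probG fun z => 1 / 2 + a * k z := by
  have hac : 0 ≤ a * c := mul_nonneg ha hc
  -- The constant comes from `1/2 + a (c + f/4) ≤ (1 + 2ac)(1/2 + a f)`.
  refine Sinkhorn.bind_mem_probG (by fun_prop) K (C := 1 + 2 * (a * c)) (by positivity)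
    (fun x => ?_) hm
  have haf : 0 ≤ a * f x := mul_nonneg ha (f0 x)
  calc ∫⁻ y, ENNReal.ofReal (1 / 2 + a * k y) ∂(K x)
      = ∫⁻ y, (ENNReal.ofReal (1 / 2) + ENNReal.ofReal a * ENNReal.ofReal (k y)) ∂(K x) := by
        refine lintegral_congr fun y => ?_
        rw [ENNReal.ofReal_add (by norm_num) (mul_nonneg ha (k0 y)), ENNReal.ofReal_mul ha]
    _ = ENNReal.ofReal (1 / 2) + ENNReal.ofReal a * ∫⁻ y, ENNReal.ofReal (k y) ∂(K x) := by
        rw [lintegral_add_left measurable_const, lintegral_const_mul' _ _ ENNReal.ofReal_ne_top]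
        simp
    _ ≤ ENNReal.ofReal (1 / 2) + ENNReal.ofReal a * ENNReal.ofReal (c + f x / 4) := by
        gcongr
        exact hd x
    _ = ENNReal.ofReal (1 / 2 + a * (c + f x / 4)) := by
        have := f0 x
        rw [← ENNReal.ofReal_mul ha, ← ENNReal.ofReal_add (by norm_num) (by positivity)]
    _ ≤ _ := by
        refine ENNReal.ofReal_le_ofReal ?_
        nlinarith [mul_nonneg hac haf]

/-- When `f x + f x'` is small, both points lie in the minorized set, and removing the common part
`m` gains `κ`. When it is large, the drift alone contracts. The choice `a c = κ/4` makes the drift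
cost `2ac` of the first case exactly half of that gain. -/
theorem integral_sub_integral_le_of_drift_of_minorized [IsMarkovKernel K]
    (hk : Measurable k) (k0 : ∀ y, 0 ≤ k y) (f0 : ∀ x, 0 ≤ f x) {κ a r : ℝ} (hc : 0 < c)
    (hκ : 0 < κ) (hd : Drift K f k c) (hm : Minorized K f (8 * c) κ) (ha : a = κ / (4 * c))
    (hr₁ : 1 - κ / 2 ≤ r) (hr₂ : (1 + 4 * a * c) / (1 + 8 * a * c) ≤ r)
    {φ : Z' → ℝ} (hφ : Measurable φ) (hφk : ∀ y, |φ y| ≤ 1 / 2 + a * k y) (x x' : Z) :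
    ∫ y, φ y ∂(K x) - ∫ y, φ y ∂(K x') ≤ r * ((1 / 2 + a * f x) + (1 / 2 + a * f x')) := by
  have ha0 : 0 < a := ha ▸ by positivity
  have hac : a * c = κ / 4 := by rw [ha]; field_simp
  have ki : ∀ x, Integrable k (K x) := fun x =>
    (integrable_iff_lintegral_lt_top hk k0 _).2 ((hd x).trans_lt ENNReal.ofReal_lt_top)
  have kd : ∀ x, ∫ y, k y ∂(K x) ≤ c + f x / 4 := fun x => by
    have := hd x
    rwa [← ofReal_integral_eq_lintegral_ofReal (ki x) (Eventually.of_forall k0),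
      ENNReal.ofReal_le_ofReal_iff (by have := f0 x; positivity)] at this
  have hi : ∀ x, Integrable (fun y => 1 / 2 + a * k y) (K x) := fun x =>
    (integrable_const _).add ((ki x).const_mul a)
  have φi : ∀ x, Integrable φ (K x) := fun x =>
    (hi x).mono' hφ.aestronglyMeasurable (Eventually.of_forall hφk)
  have he : ∀ x, ∫ y, (1 / 2 + a * k y) ∂(K x) = 1 / 2 + a * ∫ y, k y ∂(K x) := fun x => by
    rw [integral_add (integrable_const _) ((ki x).const_mul a), integral_const_mul]
    simp
  have hr0 : 1 / 2 ≤ r := by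
    refine le_trans ?_ hr₂
    rw [div_le_div_iff₀ (by norm_num) (by positivity)]
    linarith
  have hs : 0 ≤ f x + f x' := add_nonneg (f0 x) (f0 x')
  rcases le_or_gt (f x + f x') (8 * c) with hR | hR
  · obtain ⟨m, hm₁, hm₂⟩ := hm
    have hx := hm₂ x (by linarith [f0 x'])
    have hx' := hm₂ x' (by linarith [f0 x])
    have : IsFiniteMeasure m := ⟨((hx Set.univ).trans_lt (measure_lt_top _ _))⟩
    have hmκ : κ ≤ m.real Set.univ := by
      rw [Measure.real, ← ENNReal.ofReal_le_iff_le_toReal (measure_ne_top _ _)]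
      exact hm₁
    have hmi := (hi x).mono_measure hx
    have φmi := (φi x).mono_measure hx
    have hmk : κ / 2 ≤ ∫ y, (1 / 2 + a * k y) ∂m := by
      have : ∫ _, (1 / 2 : ℝ) ∂m ≤ ∫ y, (1 / 2 + a * k y) ∂m :=
        integral_mono (integrable_const _) hmi fun y => by
          have := mul_nonneg ha0.le (k0 y)
          simpa using this
      simp at this
      linarith
    have key : ∀ ψ : Z' → ℝ, Measurable ψ → (∀ y, |ψ y| ≤ 1 / 2 + a * k y) → ∀ z, m ≤ K z →
        ∫ y, ψ y ∂(K z) - ∫ y, ψ y ∂m ≤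
          ∫ y, (1 / 2 + a * k y) ∂(K z) - ∫ y, (1 / 2 + a * k y) ∂m := by
      intro ψ hψ hψk z hz
      have ψi : Integrable ψ (K z) :=
        (hi z).mono' hψ.aestronglyMeasurable (Eventually.of_forall hψk)
      have h1 := integral_mono_measure hz
        (Eventually.of_forall fun y => sub_nonneg.2 (abs_le.1 (hψk y)).2) ((hi z).sub ψi)
      rw [integral_sub (hi z) ψi,
        integral_sub ((hi z).mono_measure hz) (ψi.mono_measure hz)] at h1
      linarith
    have h1 := key φ hφ hφk x hx
    have h2 := key (fun y => -φ y) hφ.neg (fun y => by simpa using hφk y) x' hx'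
    rw [integral_neg, integral_neg] at h2
    rw [he] at h1 h2
    have d1 := mul_le_mul_of_nonneg_left (kd x) ha0.le
    have d2 := mul_le_mul_of_nonneg_left (kd x') ha0.le
    have := mul_nonneg ha0.le hs
    -- With `s = f x + f x'`, the total is at most `1 + 2ac - κ + a s/4 = 1 - κ/2 + a s/4`, and `r`
    -- dominates both `1 - κ/2` and `1/4`.
    nlinarith [mul_le_mul_of_nonneg_right hr0 this]
  · have h1 : ∫ y, φ y ∂(K x) ≤ 1 / 2 + a * ∫ y, k y ∂(K x) := by
      rw [← he]
      exact integral_mono (φi x) (hi x) fun y => (abs_le.1 (hφk y)).2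
    have h2 : -(1 / 2 + a * ∫ y, k y ∂(K x')) ≤ ∫ y, φ y ∂(K x') := by
      rw [← he, ← integral_neg]
      exact integral_mono (hi x').neg (φi x') fun y => (abs_le.1 (hφk y)).1
    have d1 := mul_le_mul_of_nonneg_left (kd x) ha0.le
    have d2 := mul_le_mul_of_nonneg_left (kd x') ha0.le
    have hR' := mul_le_mul_of_nonneg_left hR.le ha0.le
    -- The drift bound `1 + 2ac + a s/4` is at most `1 + a s/2` because `s > 8c`. The ratio `(1 + a
    -- s/2)/(1 + a s)` decreases in `s`, and its value at `s = 8c` is the bound in `hr₂`.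
    have : 1 + a * (f x + f x') / 2 ≤ r * (1 + a * (f x + f x')) := by
      refine le_trans ?_ (mul_le_mul_of_nonneg_right hr₂ (by positivity))
      rw [div_mul_eq_mul_div, le_div_iff₀ (by positivity)]
      nlinarith
    linarith

theorem lip_le_of_drift_of_minorized [IsMarkovKernel K] (hf : Measurable f)
    (hk : Measurable k) (k0 : ∀ y, 0 ≤ k y) (f0 : ∀ x, 0 ≤ f x) {κ a r : ℝ} (hc : 0 < c)
    (hκ : 0 < κ) (hd : Drift K f k c) (hm : Minorized K f (8 * c) κ) (ha : a = κ / (4 * c))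
    (hr₁ : 1 - κ / 2 ≤ r) (hr₂ : (1 + 4 * a * c) / (1 + 8 * a * c) ≤ r) :
    lip (fun z => 1 / 2 + a * f z) (fun z => 1 / 2 + a * k z) K ≤ ENNReal.ofReal r := by
  have ha0 : 0 < a := ha ▸ by positivity
  refine lip_le_of_pointwise (by fun_prop)
    (fun z => add_nonneg (by norm_num) (mul_nonneg ha0.le (f0 z))) (by fun_prop)
    (fun z => add_nonneg (by norm_num) (mul_nonneg ha0.le (k0 z))) K
    (fun m h => hd.bind_mem_probG hk k0 f0 hc.le ha0.le h) (le_trans (by positivity) hr₂) ?_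
  intro φ hφ hφk x x'
  exact integral_sub_integral_le_of_drift_of_minorized hk k0 f0 hc hκ hd hm ha hr₁ hr₂ hφ hφk x x'

end Contraction

/-- The function `x ↦ 1 / ∫ e^{-W(x,y)} v(y) η(dy)`. -/
noncomputable def schrodinger {X Y : Type*} [MeasurableSpace Y] (η : Measure Y) (W : X → Y → ℝ)
    (v : Y → ℝ) : X → ℝ :=
  fun x => (∫ y, Real.exp (-W x y) * v y ∂η)⁻¹

/-- Positive measurable functions which are integrable together with their logarithm. -/
structure LogIntegrable {X : Type*} [MeasurableSpace X] (μ : Measure X) (u : X → ℝ) : Prop where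
  measurable : Measurable u
  pos : ∀ x, 0 < u x
  integrable : Integrable u μ
  integrable_log : Integrable (fun x => Real.log (u x)) μ

/-! ### One step of the potential recursion. -/

section Schrodinger

variable {X Y : Type*} [MeasurableSpace X] [MeasurableSpace Y] {μ : Measure X} {η : Measure Y}
  [IsProbabilityMeasure μ] [IsProbabilityMeasure η] {W : X → Y → ℝ} {u : X → ℝ} {v : Y → ℝ} {M : ℝ}

theorem measurable_schrodinger (hW : Measurable (Function.uncurry W)) (hv : Measurable v) :
    Measurable (schrodinger η W v) := by
  have h : Measurable (Function.uncurry fun x y => Real.exp (-W x y) * v y) :=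
    (hW.neg.exp).mul (hv.comp measurable_snd)
  exact (h.stronglyMeasurable.integral_prod_right).measurable.inv

omit [IsProbabilityMeasure η] in
theorem integrable_exp_neg_mul (hW : Measurable (Function.uncurry W))
    (hM : ∀ x y, Real.exp (-W x y) ≤ M) (hv : Integrable v η) (x : X) :
    Integrable (fun y => Real.exp (-W x y) * v y) η := by
  have hWx : Measurable (W x) := hW.of_uncurry_left
  refine hv.bdd_mul (c := M) hWx.neg.exp.aestronglyMeasurable
    (Eventually.of_forall fun y => ?_)
  rw [Real.norm_of_nonneg (Real.exp_nonneg _)]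
  exact hM x y

theorem exp_integral_le {f : Y → ℝ} (hf : Integrable f η)
    (he : Integrable (fun y => Real.exp (f y)) η) :
    Real.exp (∫ y, f y ∂η) ≤ ∫ y, Real.exp (f y) ∂η :=
  convexOn_exp.map_integral_le Real.continuous_exp.continuousOn isClosed_univ
    (Eventually.of_forall fun _ => Set.mem_univ _) hf he

/-- Jensen's inequality for `exp`, applied to `log v - W x` under `η`. -/
theorem exp_le_integral_exp_neg_mul (hW : Measurable (Function.uncurry W))
    (hM : ∀ x y, Real.exp (-W x y) ≤ M) (hWi : ∀ x, Integrable (W x) η)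
    (hv : LogIntegrable η v) (x : X) :
    Real.exp (∫ y, Real.log (v y) ∂η - ∫ y, W x y ∂η) ≤ ∫ y, Real.exp (-W x y) * v y ∂η := by
  have e : ∀ y, Real.exp (-W x y) * v y = Real.exp (Real.log (v y) - W x y) := fun y => by
    rw [sub_eq_neg_add, Real.exp_add, Real.exp_log (hv.pos y)]
  have hi := integrable_exp_neg_mul hW hM hv.integrable x
  simp_rw [e] at hi ⊢
  rw [← integral_sub hv.integrable_log (hWi x)]
  exact exp_integral_le (hv.integrable_log.sub (hWi x)) hi

theorem integral_exp_neg_mul_pos (hW : Measurable (Function.uncurry W))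
    (hM : ∀ x y, Real.exp (-W x y) ≤ M) (hWi : ∀ x, Integrable (W x) η)
    (hv : LogIntegrable η v) (x : X) : 0 < ∫ y, Real.exp (-W x y) * v y ∂η :=
  (Real.exp_pos _).trans_le (exp_le_integral_exp_neg_mul hW hM hWi hv x)

theorem schrodinger_pos (hW : Measurable (Function.uncurry W))
    (hM : ∀ x y, Real.exp (-W x y) ≤ M) (hWi : ∀ x, Integrable (W x) η)
    (hv : LogIntegrable η v) (x : X) : 0 < schrodinger η W v x :=
  inv_pos.2 (integral_exp_neg_mul_pos hW hM hWi hv x)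

theorem schrodinger_le (hW : Measurable (Function.uncurry W))
    (hM : ∀ x y, Real.exp (-W x y) ≤ M) (hWi : ∀ x, Integrable (W x) η)
    (hv : LogIntegrable η v) (x : X) :
    schrodinger η W v x ≤ Real.exp (∫ y, W x y ∂η - ∫ y, Real.log (v y) ∂η) := by
  rw [schrodinger, inv_le_comm₀ (integral_exp_neg_mul_pos hW hM hWi hv x) (Real.exp_pos _),
    ← Real.exp_neg, neg_sub]
  exact exp_le_integral_exp_neg_mul hW hM hWi hv x

theorem le_schrodinger (hW : Measurable (Function.uncurry W))
    (hM : ∀ x y, Real.exp (-W x y) ≤ M) (hWi : ∀ x, Integrable (W x) η)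
    (hv : LogIntegrable η v) (x : X) : (M * ∫ y, v y ∂η)⁻¹ ≤ schrodinger η W v x := by
  refine inv_anti₀ (integral_exp_neg_mul_pos hW hM hWi hv x) ?_
  rw [← integral_const_mul]
  exact integral_mono (integrable_exp_neg_mul hW hM hv.integrable x) (hv.integrable.const_mul M)
    fun y => mul_le_mul_of_nonneg_right (hM x y) (hv.pos y).le

theorem LogIntegrable.integral_pos (hv : LogIntegrable η v) : 0 < ∫ y, v y ∂η := by
  rw [integral_pos_iff_support_of_nonneg (fun y => (hv.pos y).le) hv.integrable]
  have : Function.support v = Set.univ := Set.eq_univ_of_forall fun y => (hv.pos y).ne'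
  simp [this]

/-- The image lies between a positive constant and a multiple of `e^{W^V}`; hence its logarithm lies
between a constant and `W^V` plus a constant. -/
theorem logIntegrable_schrodinger (hW : Measurable (Function.uncurry W)) (M0 : 0 < M)
    (hM : ∀ x y, Real.exp (-W x y) ≤ M) (hWi : ∀ x, Integrable (W x) η)
    (hWV : Integrable (fun x => ∫ y, W x y ∂η) μ)
    (hWVe : Integrable (fun x => Real.exp (∫ y, W x y ∂η)) μ) (hv : LogIntegrable η v) :
    LogIntegrable μ (schrodinger η W v) := by
  have hm := measurable_schrodinger (η := η) hW hv.measurable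
  have hp := schrodinger_pos hW hM hWi hv
  refine ⟨hm, hp, ?_, ?_⟩
  · refine (hWVe.div_const (Real.exp (∫ y, Real.log (v y) ∂η))).mono' hm.aestronglyMeasurable
      (Eventually.of_forall fun x => ?_)
    rw [Real.norm_of_nonneg (hp x).le, ← Real.exp_sub]
    exact schrodinger_le hW hM hWi hv x
  · refine ((hWV.sub (integrable_const (∫ y, Real.log (v y) ∂η))).abs.add
      (integrable_const |Real.log (M * ∫ y, v y ∂η)⁻¹|)).mono'
      hm.log.aestronglyMeasurable (Eventually.of_forall fun x => ?_)
    have h1 : Real.log (schrodinger η W v x) ≤ ∫ y, W x y ∂η - ∫ y, Real.log (v y) ∂η := by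
      rw [Real.log_le_iff_le_exp (hp x)]
      exact schrodinger_le hW hM hWi hv x
    have h2 : Real.log (M * ∫ y, v y ∂η)⁻¹ ≤ Real.log (schrodinger η W v x) :=
      Real.log_le_log (inv_pos.2 (mul_pos M0 hv.integral_pos)) (le_schrodinger hW hM hWi hv x)
    rw [Real.norm_eq_abs, abs_le]
    constructor
    · have := neg_abs_le (Real.log (M * ∫ y, v y ∂η)⁻¹)
      have := abs_nonneg (∫ y, W x y ∂η - ∫ y, Real.log (v y) ∂η)
      simp only [Pi.add_apply, Pi.sub_apply]
      linarith
    · have := abs_nonneg (Real.log (M * ∫ y, v y ∂η)⁻¹)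
      have := le_abs_self (∫ y, W x y ∂η - ∫ y, Real.log (v y) ∂η)
      simp only [Pi.add_apply, Pi.sub_apply]
      linarith

/-- One full Sinkhorn step does not decrease the integral of the logarithm. -/
theorem integral_log_le_integral_log_schrodinger (hW : Measurable (Function.uncurry W))
    (hM : ∀ x y, Real.exp (-W x y) ≤ M) (hWi : ∀ y, Integrable (fun x => W x y) μ)
    (hu : LogIntegrable μ u) (hv : LogIntegrable η (schrodinger μ (fun y x => W x y) u))
    (hu' : LogIntegrable μ (schrodinger η W (schrodinger μ (fun y x => W x y) u))) :
    ∫ x, Real.log (u x) ∂μ ≤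
      ∫ x, Real.log (schrodinger η W (schrodinger μ (fun y x => W x y) u) x) ∂μ := by
  have hW' : Measurable (Function.uncurry fun y x => W x y) := hW.comp measurable_swap
  set v := schrodinger μ (fun y x => W x y) u with hvdef
  set u' := schrodinger η W v with hu'def
  have hprod : Integrable (fun z : X × Y => Real.exp (-W z.1 z.2) * (u z.1 * v z.2))
      (μ.prod η) := by
    refine (hu.integrable.mul_prod hv.integrable).bdd_mul (c := M)
      (hW.neg.exp).aestronglyMeasurable (Eventually.of_forall fun z => ?_)
    rw [Real.norm_of_nonneg (Real.exp_nonneg _)]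
    exact hM _ _
  -- Integrating the coupling density `e^{-W} u v` in `y` gives `u / u'`, in `x` it gives `1`. By
  -- Fubini `u / u'` has `μ`-integral `1`, and `log t ≤ t - 1` concludes.
  have e1 : ∀ x, ∫ y, Real.exp (-W x y) * (u x * v y) ∂η = u x / u' x := fun x => by
    rw [hu'def, schrodinger, div_inv_eq_mul, ← integral_const_mul]
    refine integral_congr_ae (Eventually.of_forall fun y => ?_)
    ring
  have e2 : ∀ y, ∫ x, Real.exp (-W x y) * (u x * v y) ∂μ = 1 := fun y => by
    have hpos := integral_exp_neg_mul_pos hW' (fun y x => hM x y) hWi hu y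
    have : ∀ x, Real.exp (-W x y) * (u x * v y) = v y * (Real.exp (-W x y) * u x) :=
      fun x => by ring
    simp_rw [this]
    rw [integral_const_mul, hvdef, schrodinger, inv_mul_cancel₀ hpos.ne']
  have hint : Integrable (fun x => u x / u' x) μ := by
    have := hprod.integral_prod_left
    simpa only [e1] using this
  have hone : ∫ x, u x / u' x ∂μ = 1 := by
    have h := integral_integral_swap (f := fun x y => Real.exp (-W x y) * (u x * v y)) hprod
    simp only [e1, e2] at h
    simpa using h
  have hle : ∫ x, (Real.log (u x) - Real.log (u' x)) ∂μ ≤ ∫ x, (u x / u' x - 1) ∂μ := by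
    refine integral_mono (hu.integrable_log.sub hu'.integrable_log)
      (hint.sub (integrable_const _)) fun x => ?_
    simp only
    rw [← Real.log_div (hu.pos x).ne' (hu'.pos x).ne']
    exact Real.log_le_sub_one_of_pos (div_pos (hu.pos x) (hu'.pos x))
  rw [integral_sub hu.integrable_log hu'.integrable_log, integral_sub hint (integrable_const _),
    hone] at hle
  simp at hle
  exact hle

end Schrodinger

/-- The density of `e^{-U_{2n}}` with respect to `e^{-U}`, where `U_{2n}` is the Sinkhorn
potential. -/
noncomputable def sinkhornLeft {X Y : Type*} [MeasurableSpace X] [MeasurableSpace Y]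
    (μ : Measure X) (η : Measure Y) (W : X → Y → ℝ) : ℕ → X → ℝ
  | 0 => fun _ => 1
  | n + 1 => schrodinger η W (schrodinger μ (fun y x => W x y) (sinkhornLeft μ η W n))

/-- The density of `e^{-V_{2n+1}}` with respect to `e^{-V}`, where `V_{2n+1}` is the Sinkhorn
potential. -/
noncomputable def sinkhornRight {X Y : Type*} [MeasurableSpace X] [MeasurableSpace Y]
    (μ : Measure X) (η : Measure Y) (W : X → Y → ℝ) (n : ℕ) : Y → ℝ :=
  schrodinger μ (fun y x => W x y) (sinkhornLeft μ η W n)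

/-- Integrability conditions on the cost function. -/
structure CostBounds {X Y : Type*} [MeasurableSpace X] [MeasurableSpace Y]
    (μ : Measure X) (η : Measure Y) (W : X → Y → ℝ) (M : ℝ) : Prop where
  measurable : Measurable (Function.uncurry W)
  pos : 0 < M
  bound : ∀ x y, Real.exp (-W x y) ≤ M
  integrable_left : ∀ x, Integrable (W x) η
  integrable_right : ∀ y, Integrable (fun x => W x y) μ
  integrable_integral_left : Integrable (fun x => ∫ y, W x y ∂η) μ
  integrable_integral_right : Integrable (fun y => ∫ x, W x y ∂μ) η
  integrable_exp_left : Integrable (fun x => Real.exp (∫ y, W x y ∂η)) μ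
  integrable_exp_right : Integrable (fun y => Real.exp (∫ x, W x y ∂μ)) η

/-! ### Bounds on the Sinkhorn potentials, uniform in `n`. -/

section Potentials

variable {X Y : Type*} [MeasurableSpace X] [MeasurableSpace Y] {μ : Measure X} {η : Measure Y}
  {W : X → Y → ℝ} {M : ℝ}

theorem CostBounds.swap (h : CostBounds μ η W M) : CostBounds η μ (fun y x => W x y) M where
  measurable := h.measurable.comp measurable_swap
  pos := h.pos
  bound y x := h.bound x y
  integrable_left := h.integrable_right
  integrable_right := h.integrable_left
  integrable_integral_left := h.integrable_integral_right
  integrable_integral_right := h.integrable_integral_left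
  integrable_exp_left := h.integrable_exp_right
  integrable_exp_right := h.integrable_exp_left

variable [IsProbabilityMeasure μ] [IsProbabilityMeasure η]

theorem CostBounds.logIntegrable (h : CostBounds μ η W M) {v : Y → ℝ} (hv : LogIntegrable η v) :
    LogIntegrable μ (schrodinger η W v) :=
  logIntegrable_schrodinger h.measurable h.pos h.bound h.integrable_left
    h.integrable_integral_left h.integrable_exp_left hv

theorem logIntegrable_sinkhornLeft (h : CostBounds μ η W M) (n : ℕ) :
    LogIntegrable μ (sinkhornLeft μ η W n) := by
  induction n with
  | zero => exact ⟨measurable_const, fun _ => one_pos, integrable_const _, by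
      simp [sinkhornLeft]⟩
  | succ n ih => exact h.logIntegrable (h.swap.logIntegrable ih)

theorem logIntegrable_sinkhornRight (h : CostBounds μ η W M) (n : ℕ) :
    LogIntegrable η (sinkhornRight μ η W n) :=
  h.swap.logIntegrable (logIntegrable_sinkhornLeft h n)

theorem integral_log_sinkhornLeft_nonneg (h : CostBounds μ η W M) (n : ℕ) :
    0 ≤ ∫ x, Real.log (sinkhornLeft μ η W n x) ∂μ := by
  induction n with
  | zero => simp [sinkhornLeft]
  | succ n ih =>
    exact ih.trans (integral_log_le_integral_log_schrodinger h.measurable h.bound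
      h.integrable_right (logIntegrable_sinkhornLeft h n) (logIntegrable_sinkhornRight h n)
      (logIntegrable_sinkhornLeft h (n + 1)))

/-- Monotonicity reduces this to `n = 0`, where `v_0 ≥ 1/M` pointwise. -/
theorem integral_log_sinkhornRight_ge (h : CostBounds μ η W M) (n : ℕ) :
    -Real.log M ≤ ∫ y, Real.log (sinkhornRight μ η W n y) ∂η := by
  induction n with
  | zero =>
    have h1 := logIntegrable_sinkhornRight h 0
    have : ∫ _, -Real.log M ∂η ≤ ∫ y, Real.log (sinkhornRight μ η W 0 y) ∂η := by
      refine integral_mono (integrable_const _) h1.integrable_log fun y => ?_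
      have h2 := le_schrodinger h.swap.measurable h.swap.bound h.integrable_right
        (logIntegrable_sinkhornLeft h 0) y
      simp only
      rw [← Real.log_inv]
      refine Real.log_le_log (inv_pos.2 h.pos) ?_
      simpa [sinkhornRight, sinkhornLeft] using h2
    simpa using this
  | succ n ih =>
    exact ih.trans (integral_log_le_integral_log_schrodinger h.swap.measurable h.swap.bound
      h.integrable_left (logIntegrable_sinkhornRight h n) (logIntegrable_sinkhornLeft h (n + 1))
      (logIntegrable_sinkhornRight h (n + 1)))

theorem sinkhornRight_le (h : CostBounds μ η W M) (n : ℕ) (y : Y) :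
    sinkhornRight μ η W n y ≤ Real.exp (∫ x, W x y ∂μ) := by
  refine (schrodinger_le h.swap.measurable h.swap.bound h.integrable_right
    (logIntegrable_sinkhornLeft h n) y).trans (Real.exp_le_exp.2 ?_)
  linarith [integral_log_sinkhornLeft_nonneg h n]

theorem sinkhornLeft_le (h : CostBounds μ η W M) (n : ℕ) (x : X) :
    sinkhornLeft μ η W n x ≤ M * Real.exp (∫ y, W x y ∂η) := by
  have hexp : M * Real.exp (∫ y, W x y ∂η) = Real.exp (Real.log M + ∫ y, W x y ∂η) := by
    rw [Real.exp_add, Real.exp_log h.pos]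
  rw [hexp]
  cases n with
  | zero =>
    -- For `u_0 = 1` there is no Jensen bound; instead `W ≥ -log M` gives `1 ≤ M e^{W^V}`.
    have : ∫ _, -Real.log M ∂η ≤ ∫ y, W x y ∂η := by
      refine integral_mono (integrable_const _) (h.integrable_left x) fun y => ?_
      have := Real.log_le_log (Real.exp_pos _) (h.bound x y)
      rw [Real.log_exp] at this
      simp only
      linarith
    simp only [integral_const, probReal_univ, one_smul] at this
    exact Real.one_le_exp (by linarith)
  | succ n =>
    refine (schrodinger_le h.measurable h.bound h.integrable_left
      (logIntegrable_sinkhornRight h n) x).trans (Real.exp_le_exp.2 ?_)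
    linarith [integral_log_sinkhornRight_ge h n]

/-- The upper bound on `u_n` bounds the denominator that defines `v_n`. -/
theorem exists_le_sinkhornRight (h : CostBounds μ η W M) :
    ∃ c, 0 < c ∧ ∀ n y, c ≤ sinkhornRight μ η W n y := by
  have hI : 0 < ∫ x, Real.exp (∫ y, W x y ∂η) ∂μ := integral_exp_pos h.integrable_exp_left
  have hM := h.pos
  refine ⟨(M * (M * ∫ x, Real.exp (∫ y, W x y ∂η) ∂μ))⁻¹, by positivity, fun n y => ?_⟩
  have hn := logIntegrable_sinkhornLeft h n
  refine le_trans (inv_anti₀ (mul_pos h.pos hn.integral_pos) ?_)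
    (le_schrodinger h.swap.measurable h.swap.bound h.integrable_right hn y)
  refine mul_le_mul_of_nonneg_left ?_ h.pos.le
  rw [← integral_const_mul]
  exact integral_mono hn.integrable (h.integrable_exp_left.const_mul M)
    fun x => sinkhornLeft_le h n x

theorem exists_le_sinkhornLeft (h : CostBounds μ η W M) :
    ∃ c, 0 < c ∧ ∀ n x, c ≤ sinkhornLeft μ η W n x := by
  have hI : 0 < ∫ y, Real.exp (∫ x, W x y ∂μ) ∂η := integral_exp_pos h.integrable_exp_right
  have hM := h.pos
  refine ⟨min 1 (M * ∫ y, Real.exp (∫ x, W x y ∂μ) ∂η)⁻¹, by positivity, fun n x => ?_⟩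
  cases n with
  | zero => exact min_le_left _ _
  | succ n =>
    have hn := logIntegrable_sinkhornRight h n
    refine le_trans (min_le_right _ _) (le_trans (inv_anti₀ (mul_pos h.pos hn.integral_pos) ?_)
      (le_schrodinger h.measurable h.bound h.integrable_left hn x))
    refine mul_le_mul_of_nonneg_left ?_ h.pos.le
    exact integral_mono hn.integrable h.integrable_exp_right fun y => sinkhornRight_le h n y

end Potentials

/-! ### Locally bounded functions, compact sub-level sets and the class `B_0`. -/

section OneSpace

variable {Z : Type*} [TopologicalSpace Z] {F : Z → ℝ}

theorem LocallyBounded.exists_bound (hF : LocallyBounded F) {K : Set Z} (hK : IsCompact K) :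
    ∃ C, ∀ z ∈ K, |F z| ≤ C := by
  refine hK.induction_on ⟨0, by simp⟩ (fun s t hst ⟨C, hC⟩ => ⟨C, fun z hz => hC z (hst hz)⟩)
    (fun s t ⟨C, hC⟩ ⟨D, hD⟩ => ⟨max C D, fun z hz => ?_⟩) fun z _ => ?_
  · rcases hz with hz | hz
    · exact (hC z hz).trans (le_max_left _ _)
    · exact (hD z hz).trans (le_max_right _ _)
  · obtain ⟨C, hC⟩ := hF z
    exact ⟨_, mem_nhdsWithin_of_mem_nhds hC, C, fun w hw => hw⟩

theorem LocallyBounded.exists_le (hF : LocallyBounded F) (hFc : CompactSublevels F) :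
    ∃ b, ∀ z, b ≤ F z := by
  obtain ⟨C, hC⟩ := hF.exists_bound (hFc 0)
  refine ⟨min (-C) 0, fun z => ?_⟩
  rcases le_or_gt (F z) 0 with h | h
  · exact (min_le_left _ _).trans (abs_le.1 (hC z h)).1
  · exact (min_le_right _ _).trans h.le

theorem CompactSublevels.measurable [T2Space Z] [MeasurableSpace Z] [BorelSpace Z]
    (hFc : CompactSublevels F) : Measurable F :=
  measurable_of_Iic fun l => (hFc l).isClosed.measurableSet

theorem IsBZero.exists_bound {θ : Z → ℝ} (hθ : IsBZero θ) : ∃ C, 0 < C ∧ ∀ z, θ z ≤ C := by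
  obtain ⟨c, hc, h⟩ := hθ.uniformly_positive
  refine ⟨1 / c, by positivity, fun z => ?_⟩
  have := one_div_le_one_div_of_le hc (h z)
  rwa [one_div_one_div] at this

theorem IsBZero.pos {θ : Z → ℝ} (hθ : IsBZero θ) (z : Z) : 0 < θ z := by
  obtain ⟨c, hc, h⟩ := hθ.uniformly_positive
  exact one_div_pos.1 (hc.trans_le (h z))

theorem IsBZero.exists_exp_le {θ w : Z → ℝ} (hθ : IsBZero θ) {δ : ℝ}
    (h : ∀ z, Real.exp (-(δ * F z - w z)) ≤ θ z) :
    ∃ C, 0 < C ∧ ∀ z, Real.exp (w z) ≤ C * Real.exp (δ * F z) := by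
  obtain ⟨C, hC0, hC⟩ := hθ.exists_bound
  refine ⟨C, hC0, fun z => ?_⟩
  rw [← div_le_iff₀ (Real.exp_pos _), ← Real.exp_sub]
  refine le_trans ?_ ((h z).trans (hC z))
  simp

/-- A function in `B_0` vanishes at infinity: outside the compact set `{1/θ ≤ 1/ε}` one has `θ ≤ ε`,
and on it `F` is bounded. The free `ε` is what later makes the drift factor `1/4`. -/
theorem IsBZero.exists_exp_le_add {θ w : Z → ℝ} (hθ : IsBZero θ) (hF : LocallyBounded F) {δ : ℝ}
    (hδ : 0 ≤ δ) (h : ∀ z, Real.exp (-(δ * F z - w z)) ≤ θ z) {ε : ℝ} (hε : 0 < ε) :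
    ∃ c, 0 < c ∧ ∀ z, Real.exp (w z) ≤ c + ε * Real.exp (δ * F z) := by
  obtain ⟨C, hC0, hC⟩ := hθ.exists_bound
  obtain ⟨B, hB⟩ := hF.exists_bound (hθ.compact_sublevels (1 / ε))
  refine ⟨C * Real.exp (δ * B), by positivity, fun z => ?_⟩
  have h1 : Real.exp (w z) ≤ θ z * Real.exp (δ * F z) := by
    rw [← div_le_iff₀ (Real.exp_pos _), ← Real.exp_sub]
    refine le_trans ?_ (h z)
    simp
  rcases le_or_gt (1 / θ z) (1 / ε) with hz | hz
  · have h2 : Real.exp (δ * F z) ≤ Real.exp (δ * B) :=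
      Real.exp_le_exp.2 (mul_le_mul_of_nonneg_left ((le_abs_self _).trans (hB z hz)) hδ)
    have h3 := mul_le_mul (hC z) h2 (Real.exp_nonneg _) hC0.le
    have : 0 < ε * Real.exp (δ * F z) := by positivity
    linarith
  · have h2 : θ z ≤ ε := (lt_of_one_div_lt_one_div hε hz).le
    have h3 := mul_le_mul_of_nonneg_right h2 (Real.exp_nonneg (δ * F z))
    have : 0 < C * Real.exp (δ * B) := by positivity
    linarith

end OneSpace

/-! ### Integration against Gibbs measures. -/

section Gibbs

variable {Z : Type*} [MeasurableSpace Z] {ρ : Measure Z} {F : Z → ℝ}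

theorem lintegral_gibbs (hF : Measurable F) {f : Z → ℝ≥0∞} (hf : Measurable f) :
    ∫⁻ z, f z ∂(gibbs ρ F) = ∫⁻ z, ENNReal.ofReal (Real.exp (-F z)) * f z ∂ρ :=
  lintegral_withDensity_eq_lintegral_mul _ (by fun_prop) hf

theorem integrable_exp_gibbs (hF : Measurable F) (hb : ∃ b, ∀ z, b ≤ F z) {δ : ℝ} (hδ : 0 ≤ δ)
    (hfin : gibbs ρ (fun z => (1 - 2 * δ) * F z) Set.univ < ∞) :
    Integrable (fun z => Real.exp (δ * F z)) (gibbs ρ F) := by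
  obtain ⟨b, hb⟩ := hb
  rw [integrable_iff_lintegral_lt_top (by fun_prop) fun z => Real.exp_nonneg _,
    lintegral_gibbs hF (by fun_prop)]
  have hle : ∀ z, ENNReal.ofReal (Real.exp (-F z)) * ENNReal.ofReal (Real.exp (δ * F z)) ≤
      ENNReal.ofReal (Real.exp (-(δ * b))) *
        ENNReal.ofReal (Real.exp (-((1 - 2 * δ) * F z))) := fun z => by
    rw [← ENNReal.ofReal_mul (Real.exp_nonneg _), ← ENNReal.ofReal_mul (Real.exp_nonneg _),
      ← Real.exp_add, ← Real.exp_add]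
    refine ENNReal.ofReal_le_ofReal (Real.exp_le_exp.2 ?_)
    nlinarith [mul_le_mul_of_nonneg_left (hb z) hδ]
  refine (lintegral_mono hle).trans_lt ?_
  rw [lintegral_const_mul' _ _ ENNReal.ofReal_ne_top]
  rw [gibbs, withDensity_apply _ MeasurableSet.univ, Measure.restrict_univ] at hfin
  exact ENNReal.mul_lt_top ENNReal.ofReal_lt_top hfin

end Gibbs

/-! ### Bayes' rule and time reversal. -/

section Bayes

variable {A B : Type*} [MeasurableSpace A] [MeasurableSpace B] {ρ : Measure A}

omit [MeasurableSpace B] in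
-- The factor `s b` appears in both numerator and denominator, hence drops out.
theorem bayes_ofReal_eq {F : A → ℝ} (hF : Measurable F) {s : B → ℝ} {f : A → B → ℝ}
    (f0 : ∀ a b, 0 ≤ f a b) (s0 : ∀ b, 0 < s b) (b : B) (hm : Measurable fun a => f a b)
    (hi : Integrable (fun a => f a b) (gibbs ρ F)) (hpos : 0 < ∫ a, f a b ∂(gibbs ρ F)) (a : A) :
    bayes ρ (fun a => ENNReal.ofReal (Real.exp (-F a)))
      (fun a b => ENNReal.ofReal (s b * f a b)) b a =
      ENNReal.ofReal (Real.exp (-F a) * (f a b * (∫ a, f a b ∂(gibbs ρ F))⁻¹)) := by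
  have hden : ∫⁻ a, ENNReal.ofReal (Real.exp (-F a)) * ENNReal.ofReal (s b * f a b) ∂ρ =
      ENNReal.ofReal (s b * ∫ a, f a b ∂(gibbs ρ F)) := by
    rw [← lintegral_gibbs hF (by fun_prop), ← integral_const_mul,
      ofReal_integral_eq_lintegral_ofReal (hi.const_mul _)
        (Eventually.of_forall fun a => mul_nonneg (s0 b).le (f0 a b))]
  rw [bayes, hden, ← ENNReal.ofReal_mul (Real.exp_nonneg _),
    ← ENNReal.ofReal_div_of_pos (mul_pos (s0 b) hpos)]
  congr 1
  have := (s0 b).ne'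
  have := hpos.ne'
  field_simp

/-- Two disintegrations of one joint density: integrating out `a` leaves `q`, since `l` is
normalized. -/
theorem bind_withDensity_eq {ν : Measure B} [SFinite ρ] [SFinite ν] {p : A → ℝ≥0∞}
    {q : B → ℝ≥0∞} {k : A → B → ℝ≥0∞} {l : B → A → ℝ≥0∞} (hp : Measurable p)
    (hk : Measurable (Function.uncurry k)) (hl : Measurable (Function.uncurry l))
    (h : ∀ a b, p a * k a b = q b * l b a) (hl1 : ∀ b, ∫⁻ a, l b a ∂ρ = 1) :
    (ρ.withDensity p).bind (Kernel.withDensity (Kernel.const A ν) k) = ν.withDensity q := by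
  ext s hs
  rw [Measure.bind_apply hs (Kernel.aemeasurable _), withDensity_apply _ hs,
    lintegral_withDensity_eq_lintegral_mul _ hp (Kernel.measurable_coe _ hs)]
  simp only [Pi.mul_apply, Kernel.withDensity_apply' _ hk, Kernel.const_apply]
  have hk' : ∀ a, Measurable (k a) := fun a => hk.of_uncurry_left
  have hl' : ∀ b, Measurable (l b) := fun b => hl.of_uncurry_left
  calc ∫⁻ a, p a * ∫⁻ b in s, k a b ∂ν ∂ρ = ∫⁻ a, ∫⁻ b in s, p a * k a b ∂ν ∂ρ := by
        refine lintegral_congr fun a => ?_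
        rw [lintegral_const_mul _ (hk' a)]
    _ = ∫⁻ b in s, ∫⁻ a, p a * k a b ∂ρ ∂ν :=
        lintegral_lintegral_swap ((hp.comp measurable_fst).mul hk).aemeasurable
    _ = ∫⁻ b in s, q b ∂ν := by
        refine lintegral_congr fun b => ?_
        simp_rw [h]
        rw [lintegral_const_mul _ (hl' b), hl1, mul_one]

theorem isMarkovKernel_withDensity {ν : Measure B} [SFinite ν] {k : A → B → ℝ≥0∞}
    (hk : Measurable (Function.uncurry k)) (hk1 : ∀ a, ∫⁻ b, k a b ∂ν = 1) :
    IsMarkovKernel (Kernel.withDensity (Kernel.const A ν) k) :=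
  ⟨fun a => ⟨by simpa [Kernel.withDensity_apply' _ hk] using hk1 a⟩⟩

end Bayes

/-! ### Drift and minorization for kernels given by potentials. -/

section DriftMinorization

variable {X Y : Type*} [MeasurableSpace X] [MeasurableSpace Y] {ν : Measure Y} [SFinite ν]
  {V : Y → ℝ} {W : X → Y → ℝ} {u : X → ℝ} {v : Y → ℝ}

/-- The transition with density `e^{-V(y)} e^{-W(x,y)} v(y) u(x)`. -/
noncomputable def potentialDensity (V : Y → ℝ) (W : X → Y → ℝ) (v : Y → ℝ) (u : X → ℝ) :
    X → Y → ℝ≥0∞ :=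
  fun x y => ENNReal.ofReal (Real.exp (-V y) * (Real.exp (-W x y) * v y * u x))

omit [SFinite ν] in
theorem measurable_potentialDensity (hV : Measurable V) (hW : Measurable (Function.uncurry W))
    (hv : Measurable v) (hu : Measurable u) :
    Measurable (Function.uncurry (potentialDensity V W v u)) :=
  ENNReal.measurable_ofReal.comp (((hV.comp measurable_snd).neg.exp).mul
    ((hW.neg.exp.mul (hv.comp measurable_snd)).mul (hu.comp measurable_fst)))

/-- One power `e^{δV}` is the test function and a second comes from the bound on `v`; together with
`e^{-V}` they form the weight of exponent `1 - 2δ` in condition (A). -/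
theorem lintegral_exp_potential_le (hV : Measurable V) (hW : Measurable (Function.uncurry W))
    (hv : Measurable v) (hu : Measurable u) {δ M D : ℝ}
    (hM : ∀ x y, Real.exp (-W x y) ≤ M) (hv0 : ∀ y, 0 ≤ v y) (hu0 : ∀ x, 0 ≤ u x)
    (hvD : ∀ y, v y ≤ D * Real.exp (δ * V y)) (x : X) :
    ∫⁻ y, ENNReal.ofReal (Real.exp (δ * V y))
        ∂(Kernel.withDensity (Kernel.const X ν) (potentialDensity V W v u) x) ≤
      ENNReal.ofReal (M * D * u x) * gibbs ν (fun y => (1 - 2 * δ) * V y) Set.univ := by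
  rw [Kernel.lintegral_withDensity _ (measurable_potentialDensity hV hW hv hu) _ (by fun_prop),
    gibbs, withDensity_apply _ MeasurableSet.univ, Measure.restrict_univ, Kernel.const_apply,
    ← lintegral_const_mul' _ _ ENNReal.ofReal_ne_top]
  refine lintegral_mono fun y => ?_
  have hE : Real.exp (-V y) * Real.exp (δ * V y) * Real.exp (δ * V y) =
      Real.exp (-((1 - 2 * δ) * V y)) := by
    rw [← Real.exp_add, ← Real.exp_add]
    congr 1
    ring
  have hM0 : 0 ≤ M := (Real.exp_nonneg _).trans (hM x y)
  have hE0 : 0 ≤ Real.exp (-V y) * Real.exp (δ * V y) := by positivity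
  have h1 : Real.exp (-W x y) * v y ≤ M * (D * Real.exp (δ * V y)) :=
    mul_le_mul (hM x y) (hvD y) (hv0 y) hM0
  have h2 := mul_le_mul_of_nonneg_left (mul_le_mul_of_nonneg_right h1 (hu0 x)) hE0
  have hD : 0 ≤ D * Real.exp (δ * V y) := (hv0 y).trans (hvD y)
  have hD0 : 0 ≤ D := nonneg_of_mul_nonneg_left hD (Real.exp_pos _)
  rw [potentialDensity, ← ENNReal.ofReal_mul (by
    have := hv0 y
    have := hu0 x
    positivity), ← ENNReal.ofReal_mul (by have := hu0 x; positivity), ← hE]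
  refine ENNReal.ofReal_le_ofReal ?_
  linarith

/-- On the product of a sub-level set of `U` with one of `V`, `W` is bounded, so the density is at
least a constant times `e^{-V}`. The constant sees `u` and `v` only through `c`, whence uniformity
along the Sinkhorn iteration. -/
theorem minorized_potential [TopologicalSpace X] [TopologicalSpace Y] [T2Space Y] [BorelSpace Y]
    (hVc : CompactSublevels V) (hWm : Measurable (Function.uncurry W))
    (hW : LocallyBounded (Function.uncurry W)) [IsProbabilityMeasure (gibbs ν V)] {U : X → ℝ}
    (hUc : CompactSublevels U) {δ R c : ℝ} (hδ : 0 < δ) (hR : 0 < R) (hc : 0 < c) :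
    ∃ κ, 0 < κ ∧ ∀ (u : X → ℝ) (v : Y → ℝ), Measurable u → Measurable v →
      (∀ x, c ≤ u x) → (∀ y, c ≤ v y) →
      Minorized (Kernel.withDensity (Kernel.const X ν) (potentialDensity V W v u))
        (fun x => Real.exp (δ * U x)) R κ := by
  have hVm := hVc.measurable
  obtain ⟨n, hn⟩ : ∃ n : ℕ, gibbs ν V {y | V y ≤ n} ≠ 0 := by
    by_contra! h
    have h1 := measure_iUnion_null h
    have h2 : ⋃ n : ℕ, {y | V y ≤ n} = Set.univ :=
      Set.eq_univ_of_forall fun y => Set.mem_iUnion.2 (exists_nat_ge (V y))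
    rw [h2, measure_univ] at h1
    exact one_ne_zero h1
  set S : Set Y := {y | V y ≤ n} with hS
  have hSm : MeasurableSet S := hVm measurableSet_Iic
  obtain ⟨B, hB⟩ := hW.exists_bound ((hUc (Real.log R / δ)).prod (hVc n))
  have hpos : 0 < (gibbs ν V).real S := ENNReal.toReal_pos hn (measure_ne_top _ _)
  refine ⟨c * c * Real.exp (-B) * (gibbs ν V).real S, by positivity,
    fun u v hu hv hcu hcv => ⟨ENNReal.ofReal (c * c * Real.exp (-B)) • (gibbs ν V).restrict S,
      ?_, fun x hx => ?_⟩⟩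
  · rw [ENNReal.ofReal_mul (by positivity)]
    simp
  · have hxU : U x ≤ Real.log R / δ := by
      rw [le_div_iff₀ hδ, mul_comm, ← Real.exp_le_exp, Real.exp_log hR]
      exact hx
    refine Measure.le_iff.2 fun s hs => ?_
    rw [Measure.smul_apply, Measure.restrict_apply hs, smul_eq_mul, gibbs,
      withDensity_apply _ (hs.inter hSm), Kernel.withDensity_apply' _
      (measurable_potentialDensity hVm hWm hv hu), Kernel.const_apply,
      ← lintegral_const_mul' _ _ ENNReal.ofReal_ne_top]
    refine le_trans (setLIntegral_mono' (hs.inter hSm) fun y hy => ?_)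
      (lintegral_mono_set (f := potentialDensity V W v u x) Set.inter_subset_left)
    rw [potentialDensity, ← ENNReal.ofReal_mul (by positivity)]
    refine ENNReal.ofReal_le_ofReal ?_
    have h1 : Real.exp (-B) ≤ Real.exp (-W x y) :=
      Real.exp_le_exp.2 (neg_le_neg ((le_abs_self _).trans (hB (x, y) ⟨hxU, hy.2⟩)))
    have h2 := mul_le_mul (mul_le_mul h1 (hcv y) hc.le (Real.exp_nonneg _)) (hcu x) hc.le
      (mul_nonneg (Real.exp_nonneg _) (hc.le.trans (hcv y)))
    have h3 := mul_le_mul_of_nonneg_left h2 (Real.exp_nonneg (-V y))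
    linarith

end DriftMinorization

section Drift

variable {X Y : Type*} [TopologicalSpace X] [MeasurableSpace X] [TopologicalSpace Y]
  [MeasurableSpace Y] {ν : Measure Y} [SFinite ν] {U : X → ℝ} {V : Y → ℝ} {W : X → Y → ℝ}

theorem exists_drift_potential (hU : LocallyBounded U) (hVm : Measurable V)
    (hWm : Measurable (Function.uncurry W)) {M : ℝ} (M0 : 0 < M)
    (hM : ∀ x y, Real.exp (-W x y) ≤ M) {δ : ℝ} (hδ : 0 < δ)
    (hfin : gibbs ν (fun y => (1 - 2 * δ) * V y) Set.univ < ∞)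
    {θ w : X → ℝ} {θ' w' : Y → ℝ} (hθ : IsBZero θ) (hθ' : IsBZero θ')
    (h : ∀ x, Real.exp (-(δ * U x - w x)) ≤ θ x) (h' : ∀ y, Real.exp (-(δ * V y - w' y)) ≤ θ' y)
    {C C' : ℝ} (hC : 0 < C) (hC' : 0 < C') :
    ∃ c, 0 < c ∧ ∀ (u : X → ℝ) (v : Y → ℝ), Measurable u → Measurable v → (∀ x, 0 < u x) →
      (∀ y, 0 < v y) → (∀ x, u x ≤ C * Real.exp (w x)) → (∀ y, v y ≤ C' * Real.exp (w' y)) →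
      Drift (Kernel.withDensity (Kernel.const X ν) (potentialDensity V W v u))
        (fun x => Real.exp (δ * U x)) (fun y => Real.exp (δ * V y)) c := by
  obtain ⟨D, hD0, hD⟩ := hθ'.exists_exp_le h'
  set I := (gibbs ν (fun y => (1 - 2 * δ) * V y) Set.univ).toReal with hI
  have hI0 : 0 ≤ I := ENNReal.toReal_nonneg
  have hIe : gibbs ν (fun y => (1 - 2 * δ) * V y) Set.univ ≤ ENNReal.ofReal (I + 1) := by
    rw [← ENNReal.ofReal_toReal hfin.ne]
    exact ENNReal.ofReal_le_ofReal (by linarith)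
  -- `I + 1` rather than `I` makes positivity of `G` immediate, so that `ε = 1/(4G)` can be chosen.
  set G := M * (C' * D) * C * (I + 1) with hG
  have hG0 : 0 < G := by positivity
  obtain ⟨c, hc0, hc⟩ := hθ.exists_exp_le_add hU hδ.le h (ε := 1 / (4 * G)) (by positivity)
  refine ⟨G * c, by positivity, fun u v hum hvm hu0 hv0 hu hv x => ?_⟩
  have hvD : ∀ y, v y ≤ C' * D * Real.exp (δ * V y) := fun y => by
    rw [mul_assoc]
    exact (hv y).trans (mul_le_mul_of_nonneg_left (hD y) hC'.le)
  refine (lintegral_exp_potential_le hVm hWm hvm hum hM (fun y => (hv0 y).le)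
    (fun x => (hu0 x).le) hvD x).trans ?_
  refine (mul_le_mul_right hIe _).trans ?_
  have := (hu0 x).le
  rw [← ENNReal.ofReal_mul (by positivity)]
  refine ENNReal.ofReal_le_ofReal ?_
  have h1 : u x ≤ C * (c + 1 / (4 * G) * Real.exp (δ * U x)) :=
    (hu x).trans (mul_le_mul_of_nonneg_left (hc x) hC.le)
  calc M * (C' * D) * u x * (I + 1)
      ≤ M * (C' * D) * (C * (c + 1 / (4 * G) * Real.exp (δ * U x))) * (I + 1) := by gcongr
    _ = G * c + G * (1 / (4 * G)) * Real.exp (δ * U x) := by rw [hG]; ring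
    _ = G * c + Real.exp (δ * U x) / 4 := by field_simp

end Drift

/-! ### Condition (A) implies the integrability bounds on the cost. -/

section Cost

variable {X Y : Type*} [TopologicalSpace X] [T2Space X] [MeasurableSpace X] [BorelSpace X]
  [TopologicalSpace Y] [T2Space Y] [MeasurableSpace Y] [BorelSpace Y]
  {lam : Measure X} {nu : Measure Y} {U : X → ℝ} {V : Y → ℝ} {W : X → Y → ℝ} {δ : ℝ}

omit [T2Space X] [BorelSpace X] [T2Space Y] [BorelSpace Y] in
theorem ConditionA.swap (hA : ConditionA lam nu U V W δ) :
    ConditionA nu lam V U (fun y x => W x y) δ where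
  delta_pos := hA.delta_pos
  delta_lt := hA.delta_lt
  finite_left := hA.finite_right
  finite_right := hA.finite_left
  integrable_left := hA.integrable_right
  integrable_right := hA.integrable_left
  exists_theta_left := hA.exists_theta_right
  exists_theta_right := hA.exists_theta_left

omit [T2Space Y] [BorelSpace Y] in
theorem ConditionA.integrable_exp_left (hA : ConditionA lam nu U V W δ)
    (hU : LocallyBounded U) (hUc : CompactSublevels U) :
    Integrable (fun x => Real.exp (δ * U x)) (gibbs lam U) :=
  integrable_exp_gibbs hUc.measurable (hU.exists_le hUc) hA.delta_pos.le hA.finite_left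

variable [IsProbabilityMeasure (gibbs lam U)] [IsProbabilityMeasure (gibbs nu V)]

omit [T2Space Y] [BorelSpace Y] in
theorem ConditionA.integrable_left_exp_integral (hA : ConditionA lam nu U V W δ)
    (hU : LocallyBounded U) (hUc : CompactSublevels U) (hWm : Measurable (Function.uncurry W))
    {M : ℝ} (hM : ∀ x y, Real.exp (-W x y) ≤ M) :
    Integrable (fun x => Real.exp (∫ y, W x y ∂(gibbs nu V))) (gibbs lam U) ∧
      Integrable (fun x => ∫ y, W x y ∂(gibbs nu V)) (gibbs lam U) := by
  obtain ⟨θ, hθ, h⟩ := hA.exists_theta_left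
  obtain ⟨C, hC0, hC⟩ := hθ.exists_exp_le h
  have hm : Measurable fun x => ∫ y, W x y ∂(gibbs nu V) :=
    (hWm.stronglyMeasurable.integral_prod_right).measurable
  have h1 : Integrable (fun x => Real.exp (∫ y, W x y ∂(gibbs nu V))) (gibbs lam U) := by
    refine ((hA.integrable_exp_left hU hUc).const_mul C).mono' hm.exp.aestronglyMeasurable
      (Eventually.of_forall fun x => ?_)
    rw [Real.norm_of_nonneg (Real.exp_nonneg _)]
    exact hC x
  refine ⟨h1, (h1.add (integrable_const |Real.log M|)).mono' hm.aestronglyMeasurable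
    (Eventually.of_forall fun x => ?_)⟩
  -- Integrability of `W^V` follows from that of `e^{W^V}` above and from `W^V ≥ -log M` below.
  have h2 : ∫ _, -Real.log M ∂(gibbs nu V) ≤ ∫ y, W x y ∂(gibbs nu V) := by
    refine integral_mono (integrable_const _) (hA.integrable_left x) fun y => ?_
    have := Real.log_le_log (Real.exp_pos _) (hM x y)
    rw [Real.log_exp] at this
    simp only
    linarith
  simp only [integral_const, probReal_univ, one_smul] at h2
  have h3 := le_abs_self (Real.log M)
  have h4 := Real.add_one_le_exp (∫ y, W x y ∂(gibbs nu V))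
  have h5 := Real.exp_pos (∫ y, W x y ∂(gibbs nu V))
  rw [Real.norm_eq_abs, abs_le]
  simp only [Pi.add_apply]
  constructor <;> linarith [abs_nonneg (Real.log M)]

theorem ConditionA.costBounds (hA : ConditionA lam nu U V W δ)
    (hU : LocallyBounded U) (hUc : CompactSublevels U)
    (hV : LocallyBounded V) (hVc : CompactSublevels V) (hWm : Measurable (Function.uncurry W))
    {M : ℝ} (M0 : 0 < M) (hM : ∀ x y, Real.exp (-W x y) ≤ M) :
    CostBounds (gibbs lam U) (gibbs nu V) W M := by
  have hl := hA.integrable_left_exp_integral hU hUc hWm hM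
  have hr := hA.swap.integrable_left_exp_integral hV hVc (hWm.comp measurable_swap)
    fun y x => hM x y
  exact ⟨hWm, M0, hM, hA.integrable_left, hA.integrable_right, hl.2, hr.2, hl.1, hr.1⟩

end Cost

theorem LocallyBounded.uncurry_swap {X Y : Type*} [TopologicalSpace X] [TopologicalSpace Y]
    {W : X → Y → ℝ} (h : LocallyBounded (Function.uncurry W)) :
    LocallyBounded (Function.uncurry fun y x => W x y) := by
  rintro ⟨y, x⟩
  obtain ⟨C, hC⟩ := h (x, y)
  exact ⟨C, (continuous_swap.tendsto (y, x)).eventually hC⟩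

/-! ### The Sinkhorn densities in terms of the potentials, and their invariant measures. -/

section Densities

variable {X Y : Type*} [MeasurableSpace X] [MeasurableSpace Y]
  {lam : Measure X} {nu : Measure Y} {U : X → ℝ} {V : Y → ℝ} {W : X → Y → ℝ} {M : ℝ}
  [IsProbabilityMeasure (gibbs lam U)] [IsProbabilityMeasure (gibbs nu V)]

omit [IsProbabilityMeasure (gibbs nu V)] in
theorem bayes_potential (hU : Measurable U) (hc : CostBounds (gibbs lam U) (gibbs nu V) W M)
    {u : X → ℝ} (hu : LogIntegrable (gibbs lam U) u) {s : Y → ℝ} (s0 : ∀ y, 0 < s y) :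
    bayes lam (fun x => ENNReal.ofReal (Real.exp (-U x)))
      (fun x y => ENNReal.ofReal (s y * (Real.exp (-W x y) * u x))) =
      potentialDensity U (fun y x => W x y) u (schrodinger (gibbs lam U) (fun y x => W x y) u) := by
  have hWm := hc.swap.measurable
  funext y x
  exact bayes_ofReal_eq hU (f := fun x y => Real.exp (-W x y) * u x)
    (fun a b => mul_nonneg (Real.exp_nonneg _) (hu.pos a).le) s0 y
    ((hWm.of_uncurry_left (x := y)).neg.exp.mul hu.measurable)
    (integrable_exp_neg_mul hWm hc.swap.bound hu.integrable y)
    (integral_exp_neg_mul_pos hWm hc.swap.bound hc.integrable_right hu y) x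

/-- The Sinkhorn transitions are of the form `s(y) e^{-W(x,y)} u_n(x) ν(dy)`. -/
theorem exists_evenDensity_eq (hU : Measurable U) (hV : Measurable V)
    (hc : CostBounds (gibbs lam U) (gibbs nu V) W M) (n : ℕ) :
    ∃ s : Y → ℝ, Measurable s ∧ (∀ y, 0 < s y) ∧ evenDensity lam nu U V W n = fun x y =>
      ENNReal.ofReal (s y *
        (Real.exp (-W x y) * sinkhornLeft (gibbs lam U) (gibbs nu V) W n x)) := by
  induction n with
  -- `K_0` carries no factor `e^{-V}`, so `s` must stay general; it disappears at the next Bayes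
  -- step.
  | zero => exact ⟨fun _ => 1, measurable_const, fun _ => one_pos, by
      simp [evenDensity, sinkhornLeft]⟩
  | succ n ih =>
    obtain ⟨s, hsm, s0, hs⟩ := ih
    have hu := logIntegrable_sinkhornLeft hc n
    have hv := logIntegrable_sinkhornRight hc n
    refine ⟨fun y => Real.exp (-V y) * sinkhornRight (gibbs lam U) (gibbs nu V) W n y,
      hV.neg.exp.mul hv.measurable, fun y => mul_pos (Real.exp_pos _) (hv.pos y), ?_⟩
    have h1 := bayes_potential hU hc hu s0
    have h2 := bayes_potential hV hc.swap hv
      (fun x => mul_pos (Real.exp_pos (-U x)) (hu.pos x))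
    rw [evenDensity, hs, h1]
    have h3 : potentialDensity U (fun y x => W x y) (sinkhornLeft (gibbs lam U) (gibbs nu V) W n)
        (schrodinger (gibbs lam U) (fun y x => W x y)
          (sinkhornLeft (gibbs lam U) (gibbs nu V) W n)) =
        fun y x => ENNReal.ofReal
          (Real.exp (-U x) * sinkhornLeft (gibbs lam U) (gibbs nu V) W n x *
            (Real.exp (-W x y) * sinkhornRight (gibbs lam U) (gibbs nu V) W n y)) := by
      funext y x
      rw [potentialDensity, sinkhornRight]
      congr 1
      ring
    rw [h3, h2]
    funext x y
    rw [potentialDensity, sinkhornLeft, ← sinkhornRight]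
    congr 1
    ring

theorem oddDensity_eq (hU : Measurable U) (hV : Measurable V)
    (hc : CostBounds (gibbs lam U) (gibbs nu V) W M) (n : ℕ) :
    oddDensity lam nu U V W n = potentialDensity U (fun y x => W x y)
      (sinkhornLeft (gibbs lam U) (gibbs nu V) W n)
      (sinkhornRight (gibbs lam U) (gibbs nu V) W n) := by
  obtain ⟨s, -, s0, hs⟩ := exists_evenDensity_eq hU hV hc n
  rw [oddDensity, hs]
  exact bayes_potential hU hc (logIntegrable_sinkhornLeft hc n) s0

theorem evenDensity_succ_eq (hU : Measurable U) (hV : Measurable V)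
    (hc : CostBounds (gibbs lam U) (gibbs nu V) W M) (n : ℕ) :
    evenDensity lam nu U V W (n + 1) = potentialDensity V W
      (sinkhornRight (gibbs lam U) (gibbs nu V) W n)
      (sinkhornLeft (gibbs lam U) (gibbs nu V) W (n + 1)) := by
  have hu := logIntegrable_sinkhornLeft hc n
  have h := bayes_potential hV hc.swap (logIntegrable_sinkhornRight hc n)
    (fun x => mul_pos (Real.exp_pos (-U x)) (hu.pos x))
  rw [sinkhornLeft, ← sinkhornRight, ← h]
  change bayes nu _ (oddDensity lam nu U V W n) = _
  rw [oddDensity_eq hU hV hc]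
  congr 1
  funext y x
  rw [potentialDensity]
  congr 1
  ring

theorem measurable_evenDensity (hU : Measurable U) (hV : Measurable V)
    (hc : CostBounds (gibbs lam U) (gibbs nu V) W M) (n : ℕ) :
    Measurable (Function.uncurry (evenDensity lam nu U V W n)) := by
  obtain ⟨s, hsm, -, hs⟩ := exists_evenDensity_eq hU hV hc n
  rw [hs]
  exact ENNReal.measurable_ofReal.comp ((hsm.comp measurable_snd).mul
    (hc.measurable.neg.exp.mul ((logIntegrable_sinkhornLeft hc n).measurable.comp measurable_fst)))

theorem measurable_oddDensity (hU : Measurable U) (hV : Measurable V)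
    (hc : CostBounds (gibbs lam U) (gibbs nu V) W M) (n : ℕ) :
    Measurable (Function.uncurry (oddDensity lam nu U V W n)) := by
  rw [oddDensity_eq hU hV hc]
  exact measurable_potentialDensity hU hc.swap.measurable
    (logIntegrable_sinkhornLeft hc n).measurable (logIntegrable_sinkhornRight hc n).measurable

omit [IsProbabilityMeasure (gibbs nu V)] in
theorem lintegral_potentialDensity_schrodinger (hU : Measurable U)
    (hc : CostBounds (gibbs lam U) (gibbs nu V) W M) {u : X → ℝ}
    (hu : LogIntegrable (gibbs lam U) u) (y : Y) :
    ∫⁻ x, potentialDensity U (fun y x => W x y) u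
      (schrodinger (gibbs lam U) (fun y x => W x y) u) y x ∂lam = 1 := by
  have hWm := hc.swap.measurable
  have hWy : Measurable fun x => W x y := hWm.of_uncurry_left (x := y)
  have hpos := integral_exp_neg_mul_pos hWm hc.swap.bound hc.integrable_right hu y
  have hs0 := schrodinger_pos hWm hc.swap.bound hc.integrable_right hu y
  have hi := integrable_exp_neg_mul hWm hc.swap.bound hu.integrable y
  have hum := hu.measurable
  have e : ∀ x, potentialDensity U (fun y x => W x y) u
      (schrodinger (gibbs lam U) (fun y x => W x y) u) y x =
      ENNReal.ofReal (Real.exp (-U x)) * ENNReal.ofReal (Real.exp (-W x y) * u x *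
        schrodinger (gibbs lam U) (fun y x => W x y) u y) := fun x => by
    rw [potentialDensity, ENNReal.ofReal_mul (Real.exp_nonneg _)]
  simp_rw [e]
  rw [← lintegral_gibbs hU (by fun_prop), ← ofReal_integral_eq_lintegral_ofReal (hi.mul_const _)
    (Eventually.of_forall fun x => mul_nonneg
      (mul_nonneg (Real.exp_nonneg _) (hu.pos x).le) hs0.le), integral_mul_const, schrodinger,
    mul_inv_cancel₀ hpos.ne', ENNReal.ofReal_one]

theorem lintegral_oddDensity (hU : Measurable U) (hV : Measurable V)
    (hc : CostBounds (gibbs lam U) (gibbs nu V) W M) (n : ℕ) (y : Y) :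
    ∫⁻ x, oddDensity lam nu U V W n y x ∂lam = 1 := by
  rw [oddDensity_eq hU hV hc]
  exact lintegral_potentialDensity_schrodinger hU hc (logIntegrable_sinkhornLeft hc n) y

theorem lintegral_evenDensity (hU : Measurable U) (hV : Measurable V)
    (hc : CostBounds (gibbs lam U) (gibbs nu V) W M)
    (hK : ∀ x, ∫⁻ y, ENNReal.ofReal (Real.exp (-W x y)) ∂nu = 1) (n : ℕ) (x : X) :
    ∫⁻ y, evenDensity lam nu U V W n x y ∂nu = 1 := by
  cases n with
  | zero => exact hK x
  | succ n =>
    rw [evenDensity_succ_eq hU hV hc]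
    exact lintegral_potentialDensity_schrodinger hV hc.swap (logIntegrable_sinkhornRight hc n) x

variable [SFinite lam] [SFinite nu]

/-- `μ K_{2n} K_{2n+1} = μ`. -/
theorem evenMarginal_bind_oddK (hU : Measurable U) (hV : Measurable V)
    (hc : CostBounds (gibbs lam U) (gibbs nu V) W M)
    (hK : ∀ x, ∫⁻ y, ENNReal.ofReal (Real.exp (-W x y)) ∂nu = 1) (n : ℕ) :
    (evenMarginal lam nu U V W n).bind (oddK lam nu U V W n) = gibbs lam U := by
  obtain ⟨s, hsm, s0, hs⟩ := exists_evenDensity_eq hU hV hc n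
  have hu := logIntegrable_sinkhornLeft hc n
  have hv := logIntegrable_sinkhornRight hc n
  have hk := measurable_evenDensity hU hV hc n
  have hl := measurable_oddDensity hU hV hc n
  -- The quotient `s / v_n` is the density of `π_{2n}`. The same identity is used forward to compute
  -- this marginal and backward to return to `μ`.
  have h : ∀ x y, ENNReal.ofReal (Real.exp (-U x)) * evenDensity lam nu U V W n x y =
      ENNReal.ofReal (s y / sinkhornRight (gibbs lam U) (gibbs nu V) W n y) *
        oddDensity lam nu U V W n y x := fun x y => by
    have hvy := hv.pos y
    rw [oddDensity_eq hU hV hc, hs, potentialDensity, ← ENNReal.ofReal_mul (Real.exp_nonneg _),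
      ← ENNReal.ofReal_mul (div_nonneg (s0 y).le hvy.le)]
    congr 1
    field_simp
  rw [evenMarginal, gibbs, evenK, oddK, bind_withDensity_eq (by fun_prop) hk hl h
    (lintegral_oddDensity hU hV hc n)]
  exact bind_withDensity_eq (hsm.div hv.measurable).ennreal_ofReal hl hk
    (fun y x => (h x y).symm) (lintegral_evenDensity hU hV hc hK n)

/-- `η K_{2n+1} K_{2(n+1)} = η`. -/
theorem oddMarginal_bind_evenK (hU : Measurable U) (hV : Measurable V)
    (hc : CostBounds (gibbs lam U) (gibbs nu V) W M)
    (hK : ∀ x, ∫⁻ y, ENNReal.ofReal (Real.exp (-W x y)) ∂nu = 1) (n : ℕ) :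
    (oddMarginal lam nu U V W n).bind (evenK lam nu U V W (n + 1)) = gibbs nu V := by
  have hu := logIntegrable_sinkhornLeft hc n
  have hu' := logIntegrable_sinkhornLeft hc (n + 1)
  have hk := measurable_oddDensity hU hV hc n
  have hl := measurable_evenDensity hU hV hc (n + 1)
  -- Here `e^{-U} u_n / u_{n+1}` is the density of `π_{2n+1}`.
  have h : ∀ y x, ENNReal.ofReal (Real.exp (-V y)) * oddDensity lam nu U V W n y x =
      ENNReal.ofReal (Real.exp (-U x) * sinkhornLeft (gibbs lam U) (gibbs nu V) W n x /
          sinkhornLeft (gibbs lam U) (gibbs nu V) W (n + 1) x) *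
        evenDensity lam nu U V W (n + 1) x y := fun y x => by
    have h1 := hu.pos x
    have h2 := hu'.pos x
    rw [oddDensity_eq hU hV hc, evenDensity_succ_eq hU hV hc, potentialDensity, potentialDensity,
      ← ENNReal.ofReal_mul (Real.exp_nonneg _), ← ENNReal.ofReal_mul (by positivity)]
    congr 1
    field_simp
  rw [oddMarginal, gibbs, evenK, oddK, bind_withDensity_eq (by fun_prop) hk hl h
    (lintegral_evenDensity hU hV hc hK (n + 1))]
  exact bind_withDensity_eq
    ((hU.neg.exp.mul hu.measurable).div hu'.measurable).ennreal_ofReal hl hk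
    (fun x y => (h y x).symm) (lintegral_oddDensity hU hV hc n)

end Densities

/-! ### Uniform contraction of the Sinkhorn transitions. -/

section Main

variable {X Y : Type*}
  [TopologicalSpace X] [PolishSpace X] [MeasurableSpace X] [BorelSpace X]
  [TopologicalSpace Y] [PolishSpace Y] [MeasurableSpace Y] [BorelSpace Y]
  {lam : Measure X} {nu : Measure Y} [SFinite lam] [SFinite nu]
  {U : X → ℝ} {V : Y → ℝ} {W : X → Y → ℝ} {δ M : ℝ}
  [IsProbabilityMeasure (gibbs lam U)] [IsProbabilityMeasure (gibbs nu V)]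

omit [SFinite lam] in
/-- Drift and minorization, uniformly in `n`, of the Sinkhorn transitions from `X` to `Y`. -/
theorem exists_drift_minorized_evenK (hU : LocallyBounded U) (hUc : CompactSublevels U)
    (hVc : CompactSublevels V)
    (hW : LocallyBounded (Function.uncurry W)) (hc : CostBounds (gibbs lam U) (gibbs nu V) W M)
    (hA : ConditionA lam nu U V W δ) :
    ∃ c, 0 < c ∧ (∀ n, Drift (evenK lam nu U V W (n + 1)) (fun x => Real.exp (δ * U x))
      (fun y => Real.exp (δ * V y)) c) ∧ ∀ R, 0 < R → ∃ κ, 0 < κ ∧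
        ∀ n, Minorized (evenK lam nu U V W (n + 1)) (fun x => Real.exp (δ * U x)) R κ := by
  obtain ⟨θ, hθ, h⟩ := hA.exists_theta_left
  obtain ⟨θ', hθ', h'⟩ := hA.exists_theta_right
  obtain ⟨c₁, hc₁, hl⟩ := exists_le_sinkhornLeft hc
  obtain ⟨c₂, hc₂, hr⟩ := exists_le_sinkhornRight hc
  obtain ⟨c, c0, hd⟩ := exists_drift_potential (ν := nu) (W := W) hU hVc.measurable hc.measurable
    hc.pos hc.bound hA.delta_pos hA.finite_right hθ hθ' h h' hc.pos one_pos
  refine ⟨c, c0, fun n => ?_, fun R hR => ?_⟩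
  · have hu := logIntegrable_sinkhornLeft hc (n + 1)
    have hv := logIntegrable_sinkhornRight hc n
    rw [evenK, evenDensity_succ_eq hUc.measurable hVc.measurable hc]
    exact hd _ _ hu.measurable hv.measurable hu.pos hv.pos (sinkhornLeft_le hc _)
      fun y => (sinkhornRight_le hc n y).trans_eq (one_mul _).symm
  · obtain ⟨κ, κ0, hκ⟩ := minorized_potential (ν := nu) hVc hc.measurable hW hUc hA.delta_pos hR
      (lt_min hc₁ hc₂)
    refine ⟨κ, κ0, fun n => ?_⟩
    rw [evenK, evenDensity_succ_eq hUc.measurable hVc.measurable hc]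
    exact hκ _ _ (logIntegrable_sinkhornLeft hc (n + 1)).measurable
      (logIntegrable_sinkhornRight hc n).measurable
      (fun x => (min_le_left _ _).trans (hl _ x)) fun y => (min_le_right _ _).trans (hr _ y)

omit [SFinite nu] in
/-- Drift and minorization, uniformly in `n`, of the Sinkhorn transitions from `Y` to `X`. -/
theorem exists_drift_minorized_oddK (hUc : CompactSublevels U)
    (hV : LocallyBounded V) (hVc : CompactSublevels V)
    (hW : LocallyBounded (Function.uncurry W)) (hc : CostBounds (gibbs lam U) (gibbs nu V) W M)
    (hA : ConditionA lam nu U V W δ) :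
    ∃ c, 0 < c ∧ (∀ n, Drift (oddK lam nu U V W n) (fun y => Real.exp (δ * V y))
      (fun x => Real.exp (δ * U x)) c) ∧ ∀ R, 0 < R → ∃ κ, 0 < κ ∧
        ∀ n, Minorized (oddK lam nu U V W n) (fun y => Real.exp (δ * V y)) R κ := by
  obtain ⟨θ, hθ, h⟩ := hA.exists_theta_left
  obtain ⟨θ', hθ', h'⟩ := hA.exists_theta_right
  obtain ⟨c₁, hc₁, hl⟩ := exists_le_sinkhornLeft hc
  obtain ⟨c₂, hc₂, hr⟩ := exists_le_sinkhornRight hc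
  obtain ⟨c, c0, hd⟩ := exists_drift_potential (ν := lam) (W := fun y x => W x y) hV
    hUc.measurable hc.swap.measurable hc.pos hc.swap.bound hA.delta_pos hA.finite_left hθ' hθ h' h
    one_pos hc.pos
  refine ⟨c, c0, fun n => ?_, fun R hR => ?_⟩
  · have hu := logIntegrable_sinkhornLeft hc n
    have hv := logIntegrable_sinkhornRight hc n
    rw [oddK, oddDensity_eq hUc.measurable hVc.measurable hc]
    exact hd _ _ hv.measurable hu.measurable hv.pos hu.pos
      (fun y => (sinkhornRight_le hc n y).trans_eq (one_mul _).symm) (sinkhornLeft_le hc _)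
  · obtain ⟨κ, κ0, hκ⟩ := minorized_potential (ν := lam) hUc hc.swap.measurable hW.uncurry_swap hVc
      hA.delta_pos hR (lt_min hc₁ hc₂)
    refine ⟨κ, κ0, fun n => ?_⟩
    rw [oddK, oddDensity_eq hUc.measurable hVc.measurable hc]
    exact hκ _ _ (logIntegrable_sinkhornRight hc n).measurable
      (logIntegrable_sinkhornLeft hc n).measurable
      (fun y => (min_le_right _ _).trans (hr _ y)) fun x => (min_le_left _ _).trans (hl _ x)

omit [SFinite lam] in
theorem isMarkovKernel_evenK (hUc : CompactSublevels U) (hVc : CompactSublevels V)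
    (hc : CostBounds (gibbs lam U) (gibbs nu V) W M)
    (hK : ∀ x, ∫⁻ y, ENNReal.ofReal (Real.exp (-W x y)) ∂nu = 1) (n : ℕ) :
    IsMarkovKernel (evenK lam nu U V W n) :=
  isMarkovKernel_withDensity (measurable_evenDensity hUc.measurable hVc.measurable hc n)
    (lintegral_evenDensity hUc.measurable hVc.measurable hc hK n)

omit [SFinite nu] in
theorem isMarkovKernel_oddK (hUc : CompactSublevels U) (hVc : CompactSublevels V)
    (hc : CostBounds (gibbs lam U) (gibbs nu V) W M) (n : ℕ) :
    IsMarkovKernel (oddK lam nu U V W n) :=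
  isMarkovKernel_withDensity (measurable_oddDensity hUc.measurable hVc.measurable hc n)
    (lintegral_oddDensity hUc.measurable hVc.measurable hc n)

theorem exists_lipSinkhorn (hU : LocallyBounded U) (hUc : CompactSublevels U)
    (hV : LocallyBounded V) (hVc : CompactSublevels V)
    (hW : LocallyBounded (Function.uncurry W)) (hc : CostBounds (gibbs lam U) (gibbs nu V) W M)
    (hK : ∀ x, ∫⁻ y, ENNReal.ofReal (Real.exp (-W x y)) ∂nu = 1)
    (hA : ConditionA lam nu U V W δ) :
    ∃ a r : ℝ, 0 < a ∧ 0 < r ∧ r < 1 ∧ LipSinkhorn lam nu U V W δ a r := by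
  obtain ⟨c₁, hc₁, hd₁, hm₁⟩ := exists_drift_minorized_evenK hU hUc hVc hW hc hA
  obtain ⟨c₂, hc₂, hd₂, hm₂⟩ := exists_drift_minorized_oddK hUc hV hVc hW hc hA
  have hUm := hUc.measurable
  have hVm := hVc.measurable
  -- The weight parameter `a` must serve both families of kernels, so they are given common
  -- constants: the larger drift constant and the smaller minorization mass. The sub-level `8c` is
  -- fixed only now, hence the minorization for every `R` above.
  set c := max c₁ c₂
  have c0 : 0 < c := lt_max_of_lt_left hc₁
  obtain ⟨κ₁, hκ₁, hm₁⟩ := hm₁ (8 * c) (by positivity)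
  obtain ⟨κ₂, hκ₂, hm₂⟩ := hm₂ (8 * c) (by positivity)
  set κ := min κ₁ κ₂
  have κ0 : 0 < κ := lt_min hκ₁ hκ₂
  set a := κ / (4 * c) with ha
  have a0 : 0 < a := by positivity
  refine ⟨a, max (1 - κ / 2) ((1 + 4 * a * c) / (1 + 8 * a * c)), a0,
    lt_max_of_lt_right (by positivity), max_lt (by linarith) ?_, fun n hn => sup_le ?_ ?_⟩
  · rw [div_lt_one (by positivity)]
    nlinarith [mul_pos a0 c0]
  · obtain ⟨n, rfl⟩ := Nat.exists_eq_succ_of_ne_zero (Nat.one_le_iff_ne_zero.1 hn)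
    have := isMarkovKernel_evenK hUc hVc hc hK (n + 1)
    exact lip_le_of_drift_of_minorized (by fun_prop) (by fun_prop) (fun _ => Real.exp_nonneg _)
      (fun _ => Real.exp_nonneg _) c0 κ0 ((hd₁ n).mono (le_max_left _ _))
      ((hm₁ n).mono (min_le_left _ _)) ha (le_max_left _ _) (le_max_right _ _)
  · have := isMarkovKernel_oddK hUc hVc hc n
    exact lip_le_of_drift_of_minorized (by fun_prop) (by fun_prop) (fun _ => Real.exp_nonneg _)
      (fun _ => Real.exp_nonneg _) c0 κ0 ((hd₂ n).mono (le_max_right _ _))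
      ((hm₂ n).mono (min_le_right _ _)) ha (le_max_left _ _) (le_max_right _ _)

omit [TopologicalSpace X] [PolishSpace X] [BorelSpace X] [SFinite lam] in
theorem gibbs_mem_probG_weight (hUm : Measurable U)
    (hi : Integrable (fun x => Real.exp (δ * U x)) (gibbs lam U)) {a : ℝ} (ha : 0 ≤ a) :
    gibbs lam U ∈ probG (weight a δ U) := by
  refine ⟨inferInstance, (integrable_iff_lintegral_lt_top ?_ (fun z => ?_) _).1
    ((integrable_const _).add (hi.const_mul a))⟩
  · unfold weight; fun_prop
  · unfold weight; positivity

end Main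

end Sinkhorn

theorem mainTheorem8
    {X Y : Type*}
    [TopologicalSpace X] [PolishSpace X] [LocallyCompactSpace X]
    [MeasurableSpace X] [BorelSpace X]
    [TopologicalSpace Y] [PolishSpace Y] [LocallyCompactSpace Y]
    [MeasurableSpace Y] [BorelSpace Y]
    (lam : Measure X) [IsLocallyFiniteMeasure lam]
    (nu : Measure Y) [IsLocallyFiniteMeasure nu]
    (U : X → ℝ) (V : Y → ℝ) (W : X → Y → ℝ)
    (hU : Sinkhorn.LocallyBounded U) (hUc : Sinkhorn.CompactSublevels U)
    (hV : Sinkhorn.LocallyBounded V) (hVc : Sinkhorn.CompactSublevels V)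
    (hWm : Measurable (Function.uncurry W))
    (hW : Sinkhorn.LocallyBounded (Function.uncurry W))
    (hWb : ∃ C : ℝ, ∀ x y, Real.exp (-W x y) ≤ C)
    (hmu : IsProbabilityMeasure (Sinkhorn.gibbs lam U))
    (heta : IsProbabilityMeasure (Sinkhorn.gibbs nu V))
    (hK : ∀ x, ∫⁻ y, ENNReal.ofReal (Real.exp (-W x y)) ∂nu = 1)
    (δ : ℝ) (hA : Sinkhorn.ConditionA lam nu U V W δ) :
    (∀ n : ℕ, IsMarkovKernel (Sinkhorn.evenK lam nu U V W n) ∧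
      IsMarkovKernel (Sinkhorn.oddK lam nu U V W n)) ∧
    (∃ a r : ℝ, 0 < a ∧ 0 < r ∧ r < 1 ∧ Sinkhorn.LipSinkhorn lam nu U V W δ a r) ∧
    (∀ a r : ℝ, 0 < a → 0 < r → r < 1 → Sinkhorn.LipSinkhorn lam nu U V W δ a r →
      (⨆ (n : ℕ) (_ : 1 ≤ n),
        Sinkhorn.lip (Sinkhorn.weight a δ U) (Sinkhorn.weight a δ U)
            (Sinkhorn.oddS lam nu U V W n) ⊔
          Sinkhorn.lip (Sinkhorn.weight a δ V) (Sinkhorn.weight a δ V)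
            (Sinkhorn.evenS lam nu U V W n)) ≤ ENNReal.ofReal (r ^ 2) ∧
      ∀ n : ℕ, 1 ≤ n →
        Sinkhorn.weightedTV (Sinkhorn.weight a δ V)
            (Sinkhorn.evenMarginal lam nu U V W (n + 1)) (Sinkhorn.gibbs nu V) ≤
          ENNReal.ofReal (r ^ 2) * Sinkhorn.weightedTV (Sinkhorn.weight a δ V)
            (Sinkhorn.evenMarginal lam nu U V W n) (Sinkhorn.gibbs nu V) ∧
        Sinkhorn.weightedTV (Sinkhorn.weight a δ U)
            (Sinkhorn.oddMarginal lam nu U V W n) (Sinkhorn.gibbs lam U) ≤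
          ENNReal.ofReal (r ^ 2) * Sinkhorn.weightedTV (Sinkhorn.weight a δ U)
            (Sinkhorn.oddMarginal lam nu U V W (n - 1)) (Sinkhorn.gibbs lam U)) := by
  open Sinkhorn in
  obtain ⟨M, M0, hM⟩ : ∃ M, 0 < M ∧ ∀ x y, Real.exp (-W x y) ≤ M := by
    obtain ⟨C, hC⟩ := hWb
    exact ⟨max C 1, lt_max_of_lt_right one_pos, fun x y => (hC x y).trans (le_max_left _ _)⟩
  have hc : CostBounds (gibbs lam U) (gibbs nu V) W M := hA.costBounds hU hUc hV hVc hWm M0 hM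
  have hUm := hUc.measurable
  have hVm := hVc.measurable
  have hE : ∀ n, IsMarkovKernel (evenK lam nu U V W n) := isMarkovKernel_evenK hUc hVc hc hK
  have hO : ∀ n, IsMarkovKernel (oddK lam nu U V W n) := isMarkovKernel_oddK hUc hVc hc
  refine ⟨fun n => ⟨hE n, hO n⟩, exists_lipSinkhorn hU hUc hV hVc hW hc hK hA,
    fun a r a0 r0 _ hL => ?_⟩
  obtain ⟨c₁, hc₁, hd₁, -⟩ := exists_drift_minorized_evenK hU hUc hVc hW hc hA
  obtain ⟨c₂, hc₂, hd₂, -⟩ := exists_drift_minorized_oddK hUc hV hVc hW hc hA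
  have gU : Measurable (weight a δ U) := by unfold weight; fun_prop
  have gV : Measurable (weight a δ V) := by unfold weight; fun_prop
  have pU : ∀ x, 0 < weight a δ U x := fun x => by unfold weight; positivity
  have pV : ∀ y, 0 < weight a δ V y := fun y => by unfold weight; positivity
  -- `n = 0` is excluded: the drift is established only for the even transitions from `K_2` on. The
  -- odd ones have it from `K_1` on, so `π_1` is covered as well.
  have hEG : ∀ n, 1 ≤ n → ∀ m ∈ probG (weight a δ U),
      m.bind (evenK lam nu U V W n) ∈ probG (weight a δ V) := by
    intro n hn m hm
    obtain ⟨n, rfl⟩ := Nat.exists_eq_succ_of_ne_zero (Nat.one_le_iff_ne_zero.1 hn)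
    exact (hd₁ n).bind_mem_probG (by fun_prop) (fun _ => Real.exp_nonneg _)
      (fun _ => Real.exp_nonneg _) hc₁.le a0.le hm
  have hOG : ∀ n, ∀ m ∈ probG (weight a δ V),
      m.bind (oddK lam nu U V W n) ∈ probG (weight a δ U) := fun n m hm =>
    (hd₂ n).bind_mem_probG (by fun_prop) (fun _ => Real.exp_nonneg _)
      (fun _ => Real.exp_nonneg _) hc₂.le a0.le hm
  have lE : ∀ n, 1 ≤ n → lip (weight a δ U) (weight a δ V) (evenK lam nu U V W n) ≤
      ENNReal.ofReal r := fun n hn => le_sup_left.trans (hL n hn)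
  have lO : ∀ n, 1 ≤ n → lip (weight a δ V) (weight a δ U) (oddK lam nu U V W n) ≤
      ENNReal.ofReal r := fun n hn => le_sup_right.trans (hL n hn)
  have hr2 : ENNReal.ofReal (r ^ 2) = ENNReal.ofReal r * ENNReal.ofReal r := by
    rw [← ENNReal.ofReal_mul r0.le, sq]
  have lOS : ∀ n, 1 ≤ n → lip (weight a δ U) (weight a δ U) (oddS lam nu U V W n) ≤
      ENNReal.ofReal (r ^ 2) := fun n hn => by
    rw [hr2]
    exact (lip_comp_le gU pU gV pV _ _ (hEG n hn)).trans (mul_le_mul' (lO n hn) (lE n hn))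
  have lES : ∀ n, 1 ≤ n → lip (weight a δ V) (weight a δ V) (evenS lam nu U V W n) ≤
      ENNReal.ofReal (r ^ 2) := fun n hn => by
    rw [hr2]
    exact (lip_comp_le gV pV gU pU _ _ (hOG n)).trans
      (mul_le_mul' (lE (n + 1) (by omega)) (lO n hn))
  have mU : gibbs lam U ∈ probG (weight a δ U) :=
    gibbs_mem_probG_weight hUm (hA.integrable_exp_left hU hUc) a0.le
  have mV : gibbs nu V ∈ probG (weight a δ V) :=
    gibbs_mem_probG_weight hVm (hA.swap.integrable_exp_left hV hVc) a0.le
  have bE := evenMarginal_bind_oddK hUm hVm hc hK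
  have bO := oddMarginal_bind_evenK hUm hVm hc hK
  refine ⟨iSup₂_le fun n hn => sup_le (lOS n hn) (lES n hn), fun n hn => ⟨?_, ?_⟩⟩
  · have : IsMarkovKernel (evenS lam nu U V W n) := by unfold evenS; infer_instance
    -- `S_{2n+2}` fixes `η` and maps `π_{2n}` to `π_{2n+2}`, passing through `π_{2n} K_{2n+1} = μ`.
    have h := weightedTV_bind_le_lip_mul (weight a δ V) gV pV (evenS lam nu U V W n)
      (hEG n hn _ mU) mV
    have e₁ : ((gibbs lam U).bind (evenK lam nu U V W n)).bind (evenS lam nu U V W n) =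
        evenMarginal lam nu U V W (n + 1) := by
      rw [evenS, ← Measure.comp_assoc, ← evenMarginal, bE, evenMarginal]
    have e₂ : (gibbs nu V).bind (evenS lam nu U V W n) = gibbs nu V := by
      rw [evenS, ← Measure.comp_assoc, ← oddMarginal, bO]
    rw [e₁, e₂] at h
    exact h.trans (mul_le_mul_left (lES n hn) _)
  · have : IsMarkovKernel (oddS lam nu U V W n) := by unfold oddS; infer_instance
    -- `S_{2n+1}` fixes `μ` and maps `π_{2n-1}` to `π_{2n+1}`, passing through `π_{2n-1} K_{2n} =
    -- η`.
    have h := weightedTV_bind_le_lip_mul (weight a δ U) gU pU (oddS lam nu U V W n)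
      (hOG (n - 1) _ mV) mU
    have e₁ : ((gibbs nu V).bind (oddK lam nu U V W (n - 1))).bind (oddS lam nu U V W n) =
        oddMarginal lam nu U V W n := by
      have h1 := bO (n - 1)
      rw [Nat.sub_add_cancel hn] at h1
      rw [oddS, ← Measure.comp_assoc, ← oddMarginal, h1, oddMarginal]
    have e₂ : (gibbs lam U).bind (oddS lam nu U V W n) = gibbs lam U := by
      rw [oddS, ← Measure.comp_assoc, ← evenMarginal, bE]
    rw [e₁, e₂] at h
    exact h.trans (mul_le_mul_left (lOS n hn) _)
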